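/- All graphs are finite and simple. For $K>0$, a $K$-bounded vertex distribution on a graph $G$ is a function $p_G:V(G)\to(0,\infty)$ with $\sum_{v}p_G(v)=1$ and $\frac1K\le\frac{p_G(v)}{p_G(w)}\le K$ for all adjacent $v,w$. Let $i(G,p_G)$ be the maximum of $\sum_{x\in I}p_G(x)$ over all independent sets $I\subseteq V(G)$. The Radon–Nikodym oracle of radius $r$ and depth $t$, queried at a vertex $x$, returns (up to isomorphism of rooted labeled graphs) the ball $B_r(G,x)$ rooted at $x$, in which each vertex $y$ is labeled with the number $p_G(y)/p_G(x)$ truncated to its first $t$ digits after the decimal point. A class $\mathcal G$ of graphs of vertex degree at most $d$ has Property A if for all $R\in\mathbb N$ and $\varepsilon>0$ there is $S\in\mathbb N$ such that for every $G\in\mathcal G$ there are probability measures $(\rho_x)_{x\in V(G)}$ on $V(G)$ with $\rho_x$ supported in $B_S(G,x)$ for all $x$ and $\|\rho_x-\rho_y\|_1\le\varepsilon$ whenever $x,y$ are at distance at most $R$. **Theorem.** Let $d\in\mathbb N$, and let $\mathcal G$ be either the class of all planar graphs of vertex degree at most $d$, or any class of graphs of vertex degree at most $d$ that has Property A. Then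 the weighted independence number is testable in constant time in $\mathcal G$ with Radon–Nikodym oracles, that is: for all $\varepsilon>0$ and $K>0$ there are positive integers $t,r,C$ and a finite lookup table with rational entries that assigns a number $i_{app}$ to each $C$-tuple of results of queries of radius $r$ and depth $t$ (with value $0$ for tuples not in the table), all depending only on $\varepsilon$, $K$ and $\mathcal G$, such that for every $G\in\mathcal G$ and every $K$-bounded vertex distribution $p_G$ on $G$, if $C$ vertices are sampled independently according to $p_G$ and the oracle is queried at them, then the value $i_{app}$ computed from the $C$ results satisfies $$|i(G,p_G)-i_{app}|<\varepsilon$$ with probability more than $1-\varepsilon$. -/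

import Mathlib

noncomputable section

/-- A finite simple graph. Every finite graph is isomorphic to one whose vertex type is in `Type`. -/
structure FinGraph where
  V : Type
  [fintypeV : Fintype V]
  graph : SimpleGraph V

attribute [instance] FinGraph.fintypeV

namespace FinGraph

/-- Vertex degree bound `d`. -/
def DegreeBounded (G : FinGraph) (d : ℕ) : Prop :=
  ∀ v : G.V, (G.graph.neighborSet v).ncard ≤ d

/-- The closed ball of radius `r` in the graph metric (`edist` is `⊤` across components). -/
def ball (G : FinGraph) (x : G.V) (r : ℕ) : Set G.V :=
  {y | G.graph.edist x y ≤ (r : ℕ∞)}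

end FinGraph

/-- `G` can be drawn in the plane: distinct vertices are distinct points, every edge is a simple
arc joining its endpoints, an arc meets the vertex points only at its own endpoints, and two
different arcs meet only at common endpoints. -/
def IsPlanar {V : Type*} (G : SimpleGraph V) : Prop :=
  ∃ (pt : V → EuclideanSpace ℝ (Fin 2)) (arc : G.edgeSet → Set (EuclideanSpace ℝ (Fin 2))),
    Function.Injective pt ∧
    (∀ (u v : V) (h : G.Adj u v), ∃ γ : Path (pt u) (pt v),
      Function.Injective γ ∧ Set.range γ = arc ⟨s(u, v), h⟩) ∧
    (∀ (e : G.edgeSet) (w : V), pt w ∈ arc e → w ∈ (e : Sym2 V)) ∧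
    (∀ e f : G.edgeSet, e ≠ f →
      arc e ∩ arc f ⊆ pt '' {w | w ∈ (e : Sym2 V) ∧ w ∈ (f : Sym2 V)})

/-- Yu's Property A for a class of finite graphs, uniformly over the class: for all `R` and
`ε > 0` there is `S` such that on every graph of the class there are probability measures `ρ x`,
with `ρ x` supported in the `S`-ball about `x`, whose `ℓ¹`-distance is at most `ε` for points
at distance at most `R`. -/
def PropertyA (𝒢 : Set FinGraph) : Prop :=
  ∀ (R : ℕ) (ε : ℝ), 0 < ε → ∃ S : ℕ, ∀ G ∈ 𝒢, ∃ ρ : G.V → G.V → ℝ,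
    (∀ x z, 0 ≤ ρ x z) ∧
    (∀ x, ∑ z, ρ x z = 1) ∧
    (∀ x z, ρ x z ≠ 0 → z ∈ G.ball x S) ∧
    (∀ x y, y ∈ G.ball x R → ∑ z, |ρ x z - ρ y z| ≤ ε)

/-- `p` is a (strictly positive) probability distribution on the vertices of `G` whose ratios
along edges lie between `1 / K` and `K`. -/
structure IsKWeight (G : FinGraph) (K : ℝ) (p : G.V → ℝ) : Prop where
  pos : ∀ v, 0 < p v
  sum_eq_one : ∑ v, p v = 1
  ratio : ∀ v w, G.graph.Adj v w → 1 / K ≤ p v / p w ∧ p v / p w ≤ K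

/-- The independence number of `G` with respect to `p`: the largest `p`-measure of an
independent set (the supremum is over a finite nonempty set). -/
def indepNumber (G : FinGraph) (p : G.V → ℝ) : ℝ :=
  sSup {m | ∃ I : Finset G.V, G.graph.IsIndepSet (I : Set G.V) ∧ m = ∑ x ∈ I, p x}

/-- A rooted graph whose vertices carry rational labels. -/
structure RootedLabeledGraph where
  V : Type
  graph : SimpleGraph V
  root : V
  label : V → ℚ

/-- Isomorphism of rooted labeled graphs. -/
instance RootedLabeledGraph.setoid : Setoid RootedLabeledGraph where
  r A B := ∃ f : A.graph ≃g B.graph, f A.root = B.root ∧ ∀ v, B.label (f v) = A.label v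
  iseqv :=
    { refl := fun _ => ⟨SimpleGraph.Iso.refl, rfl, fun _ => rfl⟩
      symm := by
        rintro A B ⟨f, hr, hl⟩
        refine ⟨f.symm, ?_, fun v => ?_⟩
        · rw [← hr]; exact f.symm_apply_apply A.root
        · rw [← hl (f.symm v)]; exact congrArg B.label (f.apply_symm_apply v)
      trans := by
        rintro A B C ⟨f, hr, hl⟩ ⟨g, hr', hl'⟩
        refine ⟨f.trans g, ?_, fun v => ?_⟩
        · exact (congrArg g hr).trans hr'
        · exact (hl' (f v)).trans (hl v) }

/-- The possible results of a query: rooted labeled graphs up to isomorphism. -/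
def QueryResult : Type 1 := Quotient RootedLabeledGraph.setoid

/-- The real number `a` stored up to its first `t` digits after the decimal point
(used for positive `a`). -/
def truncate (t : ℕ) (a : ℝ) : ℚ := (⌊(10 : ℝ) ^ t * a⌋ : ℚ) / 10 ^ t

/-- What the Radon-Nikodym oracle of radius `r` and depth `t` returns at the vertex `x`: the
isomorphism class of the ball `B_r(G, x)`, rooted at `x`, the label of `y` being `p y / p x`
stored up to `t` digits. -/
def oracleQuery (G : FinGraph) (p : G.V → ℝ) (r t : ℕ) (x : G.V) : QueryResult :=
  Quotient.mk RootedLabeledGraph.setoid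
    { V := G.ball x r
      graph := G.graph.induce (G.ball x r)
      root := ⟨x, by simp [FinGraph.ball]⟩
      label := fun y => truncate t (p y / p x) }

open Classical in
/-- The probability that `C` vertices sampled independently according to `p` satisfy `E`. -/
def sampleProb (G : FinGraph) (p : G.V → ℝ) (C : ℕ) (E : (Fin C → G.V) → Prop) : ℝ :=
  ∑ s : Fin C → G.V, if E s then ∏ j, p (s j) else 0

/-- The independence number is testable in constant time with Radon-Nikodym oracles in the class
`𝒢`, for unknown vertex distributions. The number `C` of queries, the radius `r`, the depth `t`
and the rule producing the answer depend on `ε`, `K` (and `𝒢`) only. The rule is one finite lookup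
table with rational entries (a finitely supported function of the `C` query results). -/
def IndepNumberTestable (𝒢 : Set FinGraph) : Prop :=
  ∀ ε K : ℝ, 0 < ε → 0 < K →
    ∃ (t r C : ℕ) (iApp : (Fin C → QueryResult) →₀ ℚ), 0 < t ∧ 0 < r ∧ 0 < C ∧
      ∀ G ∈ 𝒢, ∀ p : G.V → ℝ, IsKWeight G K p →
        1 - ε < sampleProb G p C
          (fun s => |indepNumber G p - (iApp (fun j => oracleQuery G p r t (s j)) : ℝ)| < ε)

end

/-! Two facts combine. The graphs in question are weighted hyperfinite: for every positive
probability distribution on the vertices, a set of small measure can be removed so that pieces of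
bounded diameter remain, the bound being independent of the graph and of the distribution. And for
such graphs of bounded degree the independence number is, up to a small error, the mean of a bounded
function of the weighted ball at a random vertex, hence can be estimated by sampling.

For planar graphs, hyperfiniteness is the Klein–Plotkin–Rao argument: three rounds of cutting into
breadth-first annuli, each along the lightest residue class of levels. Three vertices far apart in
one remaining component, joined to the three breadth-first roots, would form a K₃,₃ pattern
(`IsPlanar.exists_short_walk`), which a parity count of logarithm increments excludes. Under
Property A some superlevel set of a function `ρ · z` has small boundary (`exists_small_boundary`),
and such sets are peeled off one after another.

The partition cannot be read off from a ball, so a convex problem replaces it: give weights w_U ≥ 0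
to all sets U of diameter at most R and minimise Σ w_U i(U) + (λ/2) Σ p(x) slack(x)², where slack is
the uncovered part of x. Each w bounds the independence number from above up to 1/(2λ); the
hyperfinite partition supplies a w whose cost is almost as small. A fixed number of projected
gradient steps from 0 is nearly optimal on average (`SimpleGraph.abs_average_coverCost_sub_le`). In
the inner product weighted by p(U) the gradient is bounded and involves only quotients of p near U,
so the iterates depend continuously on weighted balls of bounded radius
(`SimpleGraph.exists_abs_coverIter_sub_le`). The average cost is the p-mean of
`SimpleGraph.localCost`, which an oracle answer determines up to a small error. Only finitely many
answers occur, so one rational per answer yields the table, and Chebyshev's inequality controls the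
sampling. -/

/-! ### Topology of the plane: K₃,₃ has no drawing -/

open Complex in
/-- A nowhere vanishing function on a simply connected space has a continuous logarithm. -/
theorem exists_continuous_log {A : Type*} [TopologicalSpace A] [SimplyConnectedSpace A]
    [LocallyPathConnectedSpace A] [Inhabited A] {F : A → ℂ} (hF : Continuous F)
    (h0 : ∀ x, F x ≠ 0) : ∃ L : A → ℂ, Continuous L ∧ ∀ x, exp (L x) = F x := by
  obtain ⟨L, ⟨-, hL⟩, -⟩ := isCoveringMapOn_exp.existsUnique_continuousMap_lifts
    (f := ⟨F, hF⟩) (a₀ := default) (e₀ := log (F default))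
    (Complex.exp_log (h0 default)) (fun x => by simpa using h0 x)
  exact ⟨L, L.continuous, fun x => congrFun hL x⟩

open Complex in
/-- Two continuous logarithms of the same function have the same increments. -/
theorem continuous_log_sub_eq {A : Type*} [TopologicalSpace A] [SimplyConnectedSpace A]
    [LocallyPathConnectedSpace A] {L M : A → ℂ} (hL : Continuous L)
    (hM : Continuous M) (h : ∀ x, exp (L x) = exp (M x)) (x y : A) : L x - L y = M x - M y := by
  have hs : ∀ x, exp (M x) ∈ ({0}ᶜ : Set ℂ) := fun x => by simp
  have hu := (isCoveringMapOn_exp.existsUnique_continuousMap_lifts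
    (f := ⟨fun x => exp (M x), by fun_prop⟩) (a₀ := y) (e₀ := M y) rfl hs).unique
    (y₁ := ⟨M, hM⟩) (y₂ := ⟨fun x => L x - L y + M y, by fun_prop⟩) ⟨rfl, rfl⟩
    ⟨by simp, by
      funext x
      simp [Complex.exp_add, Complex.exp_sub, h]⟩
  have := congrArg (fun f : C(A, ℂ) => f x) hu
  simp only [ContinuousMap.coe_mk] at this
  rw [this]; ring

-- Logarithms of one function differ by a constant, so the increment Λ does not depend on the
-- choice; it plays the role of a winding number for an arc that is not closed.
open Complex in
theorem exists_log_increment {f : ℝ → ℂ} (hf : Continuous f) (h0 : ∀ x, f x ≠ 0) :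
    ∃ Λ : ℂ, exp Λ * f 0 = f 1 ∧
      ∀ L : ℝ → ℂ, Continuous L → (∀ s, exp (L s) = f s) → L 1 - L 0 = Λ := by
  obtain ⟨M, hM, hMf⟩ := exists_continuous_log hf h0
  refine ⟨M 1 - M 0, ?_, fun L hL hLf => continuous_log_sub_eq hL hM (fun x => ?_) 1 0⟩
  · rw [← hMf, ← hMf, ← Complex.exp_add, sub_add_cancel]
  · rw [hLf, hMf]

open Complex in
/-- `K₃,₃` cannot be drawn in the plane so that independent edges are disjoint. -/
theorem not_exists_planar_drawing_K33 (a b : Fin 3 → ℂ) (γ : Fin 3 → Fin 3 → ℝ → ℂ)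
    (hγ : ∀ k i, Continuous (γ k i)) (h0 : ∀ k i, γ k i 0 = a k) (h1 : ∀ k i, γ k i 1 = b i)
    (hd : ∀ k l i j, k ≠ l → i ≠ j → ∀ s t, γ k i s ≠ γ l j t) : False := by
  have hex : ∀ i : Fin 3, ∃ j, i ≠ j := by decide
  have hγa : ∀ k i l, l ≠ k → ∀ s, γ k i s - a l ≠ 0 := fun k i l hl s => by
    obtain ⟨j, hj⟩ := hex i
    rw [← h0 l j]
    exact sub_ne_zero.2 (hd k l i j hl.symm hj s 0)
  have hγb : ∀ k i j, j ≠ i → ∀ s, γ k i s - b j ≠ 0 := fun k i j hj s => by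
    obtain ⟨l, hl⟩ := hex k
    rw [← h1 l j]
    exact sub_ne_zero.2 (hd k l i j hl hj.symm s 1)
  have haa : ∀ k l, l ≠ k → a k - a l ≠ 0 := fun k l h => by simpa [h0] using hγa k 0 l h 0
  have hbb : ∀ i j, j ≠ i → b i - b j ≠ 0 := fun i j h => by simpa [h1] using hγb 0 i j h 1
  have hab : ∀ k i, b i - a k ≠ 0 := fun k i => by
    obtain ⟨l, hl⟩ := hex k
    simpa [h1] using hγa l i k hl 1
  -- `P` and `Q` are the logarithm increments of an arc seen from a vertex that is not one of its
  -- ends.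
  choose P hP hP' using fun k i l (hl : l ≠ k) =>
    exists_log_increment (f := fun s => γ k i s - a l) ((hγ k i).sub continuous_const) (hγa k i l hl)
  choose Q hQ hQ' using fun k i j (hj : j ≠ i) =>
    exists_log_increment (f := fun s => γ k i s - b j) ((hγ k i).sub continuous_const) (hγb k i j hj)
  have hneg : ∀ z : ℂ, exp (z + Real.pi * I) = - exp z := fun z => by
    rw [Complex.exp_add, Complex.exp_pi_mul_I]; ring
  -- The difference of two independent arcs is nonzero on the whole parameter plane, so it has a
  -- continuous logarithm there, and both ways along the sides of the unit square from (0,0) to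
  -- (1,1) give the same increment. Where the difference appears with the opposite sign, πi is
  -- added.
  have hsq : ∀ k l i j (hl : l ≠ k) (hj : j ≠ i),
      P k i l hl + Q l j i hj.symm = P l j k hl.symm + Q k i j hj := by
    intro k l i j hl hj
    obtain ⟨L, hL, hLe⟩ := exists_continuous_log (A := ℝ × ℝ)
      (F := fun x => γ k i x.1 - γ l j x.2)
      (((hγ k i).comp continuous_fst).sub ((hγ l j).comp continuous_snd))
      (fun x => sub_ne_zero.2 (hd k l i j hl.symm hj.symm _ _))
    have e1 := hP' k i l hl (fun s => L (s, 0)) (by fun_prop) (fun s => by simp [hLe, h0])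
    have e2 := hQ' k i j hj (fun s => L (s, 1)) (by fun_prop) (fun s => by simp [hLe, h1])
    have e3 := hP' l j k hl.symm (fun t => L (0, t) + Real.pi * I) (by fun_prop)
      (fun s => by simp [hneg, hLe, h0])
    have e4 := hQ' l j i hj.symm (fun t => L (1, t) + Real.pi * I) (by fun_prop)
      (fun s => by simp [hneg, hLe, h1])
    rw [← e1, ← e2, ← e3, ← e4]; ring
  have hn : ∀ k i l (hl : l ≠ k), ∃ n : ℤ, P k i l hl =
      log (b i - a l) - log (a k - a l) + n * (2 * Real.pi * I) := fun k i l hl => by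
    rw [← Complex.exp_eq_exp_iff_exists_int, Complex.exp_sub, Complex.exp_log (hab l i),
      Complex.exp_log (haa k l hl), eq_div_iff (haa k l hl)]
    simpa [h0, h1] using hP k i l hl
  have hm : ∀ k i j (hj : j ≠ i), ∃ m : ℤ, Q k i j hj =
      log (b i - b j) - (log (b j - a k) + Real.pi * I) + m * (2 * Real.pi * I) :=
    fun k i j hj => by
    rw [← Complex.exp_eq_exp_iff_exists_int, Complex.exp_sub, hneg, Complex.exp_log (hab k j),
      Complex.exp_log (hbb i j hj), eq_div_iff (neg_ne_zero.2 (hab k j))]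
    simpa [h0, h1] using hQ k i j hj
  choose n hn using hn
  choose m hm using hm
  have hA : ∀ (c : Fin 3 → ℂ), (∀ k l, l ≠ k → c k - c l ≠ 0) → ∀ k l, l ≠ k → ∃ A : ℤ,
      log (c l - c k) = log (c k - c l) + Real.pi * I + A * (2 * Real.pi * I) := fun c hc k l hl => by
    rw [← Complex.exp_eq_exp_iff_exists_int, hneg, Complex.exp_log (hc k l hl),
      Complex.exp_log (hc l k hl.symm)]
    ring
  choose A hA' using hA a haa
  choose B hB' using hA b hbb
  have hpi : (2 * Real.pi * I : ℂ) ≠ 0 := Complex.two_pi_I_ne_zero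
  have hBB : ∀ i j (hj : j ≠ i), B i j hj + B j i hj.symm + 1 = 0 := fun i j hj => by
    have e1 := hB' i j hj
    have e2 := hB' j i hj.symm
    have : ((B i j hj + B j i hj.symm + 1 : ℤ) : ℂ) * (2 * Real.pi * I) = 0 := by
      push_cast; linear_combination -e1 - e2
    exact_mod_cast (mul_eq_zero.1 this).resolve_right hpi
  have hE : ∀ k l i j (hl : l ≠ k) (hj : j ≠ i), A k l hl + B i j hj + 1 + n k i l hl +
      m l j i hj.symm - n l j k hl.symm - m k i j hj = 0 := fun k l i j hl hj => by
    have e := hsq k l i j hl hj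
    rw [hn, hn, hm, hm, hA' k l hl, hB' i j hj] at e
    have : ((A k l hl + B i j hj + 1 + n k i l hl +
      m l j i hj.symm - n l j k hl.symm - m k i j hj : ℤ) : ℂ) * (2 * Real.pi * I) = 0 := by
      push_cast; linear_combination e
    exact_mod_cast (mul_eq_zero.1 this).resolve_right hpi
  have d01 : (1 : Fin 3) ≠ 0 := by decide
  have d02 : (2 : Fin 3) ≠ 0 := by decide
  have d12 : (2 : Fin 3) ≠ 1 := by decide
  have key : ∀ k l (hl : l ≠ k), _ := fun k l hl =>
    And.intro (hE k l 0 1 hl d01) <| And.intro (hE k l 1 0 hl d01.symm) <|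
    And.intro (hE k l 0 2 hl d02) <| And.intro (hE k l 2 0 hl d02.symm) <|
    And.intro (hE k l 1 2 hl d12) (hE k l 2 1 hl d12.symm)
  -- Parity contradiction. For fixed k, l the six relations sum to 6A + 3 + M_l − M_k + (even) = 0,
  -- where M_k is the sum of all `m k i j` and `hBB` makes the B-terms add up to −3. Taking the
  -- pairs (0,1) and (1,2) minus (0,2) cancels the M-terms and leaves an odd number equal to 0.
  have k1 := key 0 1 d01
  have k2 := key 0 2 d02
  have k3 := key 1 2 d12
  have b1 := hBB 0 1 d01
  have b2 := hBB 0 2 d02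
  have b3 := hBB 1 2 d12
  omega

/-- A walk in a drawn graph traces a path in the plane, made of arcs of its edges. -/
theorem exists_path_of_walk {X V : Type*} [TopologicalSpace X] {G : SimpleGraph V} (pt : V → X)
    (arc : G.edgeSet → Set X)
    (harc : ∀ (u v : V) (h : G.Adj u v), ∃ γ : Path (pt u) (pt v), Set.range γ = arc ⟨s(u, v), h⟩)
    {u v : V} (w : G.Walk u v) : ∃ γ : Path (pt u) (pt v), ∀ t,
      (∃ y ∈ w.support, γ t = pt y) ∨ ∃ e : G.edgeSet, (e : Sym2 V) ∈ w.edges ∧ γ t ∈ arc e := by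
  induction w with
  | nil => exact ⟨Path.refl _, fun t => Or.inl ⟨_, by simp, rfl⟩⟩
  | @cons u v w h p ih =>
    obtain ⟨γ, hγ⟩ := ih
    obtain ⟨σ, hσ⟩ := harc u v h
    refine ⟨σ.trans γ, fun t => ?_⟩
    have : (σ.trans γ) t ∈ Set.range σ ∪ Set.range γ := by
      rw [← Path.trans_range]; exact ⟨t, rfl⟩
    rcases this with h1 | ⟨s, hs⟩
    · exact Or.inr ⟨⟨s(u, v), h⟩, by simp, hσ ▸ h1⟩
    · rw [← hs]
      rcases hγ s with ⟨y, hy, e⟩ | ⟨e, he, hm⟩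
      · exact Or.inl ⟨y, by simp [hy], e⟩
      · exact Or.inr ⟨e, by simp [he], hm⟩

/-- A planar graph contains no two triples of vertices joined by walks such that walks with
different ends are vertex disjoint. -/
theorem IsPlanar.not_exists_K33 {V : Type*} {G : SimpleGraph V} (hG : IsPlanar G)
    (v x : Fin 3 → V) (w : ∀ k i, G.Walk (v k) (x i))
    (hw : ∀ k l i j, k ≠ l → i ≠ j → ∀ y ∈ (w k i).support, y ∉ (w l j).support) : False := by
  obtain ⟨pt, arc, hinj, harc, hv, he⟩ := hG
  choose γ hγ using fun k i => exists_path_of_walk pt arc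
    (fun u v h => (harc u v h).imp fun _ h => h.2) (w k i)
  let φ : EuclideanSpace ℝ (Fin 2) → ℂ := fun z => z 0 + z 1 * Complex.I
  have hφc : Continuous φ := by fun_prop
  have hφ : Function.Injective φ := fun z z' h => by
    have h1 := congrArg Complex.re h
    have h2 := congrArg Complex.im h
    simp only [φ, Complex.add_re, Complex.add_im, Complex.ofReal_re, Complex.ofReal_im,
      Complex.mul_re, Complex.mul_im, Complex.I_re, Complex.I_im] at h1 h2
    ext i; fin_cases i
    · simpa using h1
    · simpa using h2
  refine not_exists_planar_drawing_K33 (fun k => φ (pt (v k))) (fun i => φ (pt (x i)))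
    (fun k i t => φ ((γ k i).extend t)) (fun k i => hφc.comp (γ k i).continuous_extend)
    (fun k i => by simp) (fun k i => by simp) ?_
  intro k l i j hkl hij s t hst
  have hst := hφ hst
  have hw := hw k l i j hkl hij
  simp only [Path.extend, Set.IccExtend] at hst
  rcases hγ k i (Set.projIcc 0 1 zero_le_one s) with ⟨y, hy, e1⟩ | ⟨e, hem, e1⟩ <;>
    rcases hγ l j (Set.projIcc 0 1 zero_le_one t) with ⟨y', hy', e2⟩ | ⟨e', hem', e2⟩
  · exact hw y hy (by rwa [hinj (e1.symm.trans (hst.trans e2))])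
  · refine hw y hy ?_
    have := hv e' y (e1 ▸ hst ▸ e2)
    exact SimpleGraph.Walk.mem_support_of_mem_edges hem' this
  · refine hw y' ?_ hy'
    have := hv e y' (e2 ▸ hst ▸ e1)
    exact SimpleGraph.Walk.mem_support_of_mem_edges hem this
  · by_cases hee : e = e'
    · subst hee
      obtain ⟨e, heG⟩ := e
      induction e with
      | h a b =>
        exact hw a (SimpleGraph.Walk.fst_mem_support_of_mem_edges _ hem)
          (SimpleGraph.Walk.fst_mem_support_of_mem_edges _ hem')
    · obtain ⟨z, ⟨h1, h2⟩, -⟩ := he e e' hee ⟨e1, hst ▸ e2⟩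
      exact hw z (SimpleGraph.Walk.mem_support_of_mem_edges hem h1)
        (SimpleGraph.Walk.mem_support_of_mem_edges hem' h2)

/-! ### Cutting a graph into breadth-first annuli -/

namespace SimpleGraph

variable {V : Type*}

/-- Remove all edges at the vertices of `Y`. -/
def isolate (H : SimpleGraph V) (Y : Set V) : SimpleGraph V where
  Adj x y := H.Adj x y ∧ x ∉ Y ∧ y ∉ Y
  symm := ⟨fun _ _ h => ⟨h.1.symm, h.2.2, h.2.1⟩⟩
  loopless := ⟨fun _ h => H.loopless.irrefl _ h.1⟩

theorem isolate_le (H : SimpleGraph V) (Y : Set V) : H.isolate Y ≤ H := fun _ _ h => h.1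

theorem Walk.exists_isolate {H : SimpleGraph V} {Y : Set V} {u z : V} (w : H.Walk u z)
    (hw : ∀ y ∈ w.support, y ∉ Y) : ∃ w' : (H.isolate Y).Walk u z, w'.length = w.length := by
  refine ⟨w.transfer _ fun e he => ?_, w.length_transfer _⟩
  induction e with
  | h a b =>
    exact ⟨w.adj_of_mem_edges he, hw _ (w.fst_mem_support_of_mem_edges he),
      hw _ (w.snd_mem_support_of_mem_edges he)⟩

/-- `H'` arises from `H` by cutting every component into breadth-first annuli of width `m`. -/
def IsChop (H H' : SimpleGraph V) (m : ℕ) : Prop :=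
  H' ≤ H ∧ ∀ v, (∃ y, H'.Adj v y) → ∃ (ρ : V) (a : ℕ), H.Reachable ρ v ∧
    (∀ y, H'.Reachable v y → a ≤ H.dist ρ y ∧ H.dist ρ y < a + m) ∧
    ∀ (u z : V) (w : H.Walk u z), H'.Reachable v u →
      (∀ y ∈ w.support, a ≤ H.dist ρ y ∧ H.dist ρ y ≤ H.dist ρ u) →
      ∃ w' : H'.Walk u z, w'.length = w.length

theorem Reachable.dist_le_succ {H : SimpleGraph V} {ρ x y : V} (hr : H.Reachable ρ x)
    (h : H.Adj x y) : H.dist ρ y ≤ H.dist ρ x + 1 := by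
  obtain ⟨w, hw⟩ := hr.exists_walk_length_eq_dist
  rw [← hw]
  simpa using H.dist_le (w.concat h)

theorem Reachable.dist_le_add_length {H : SimpleGraph V} {ρ x y : V} (hr : H.Reachable ρ x)
    (w : H.Walk x y) : H.dist ρ y ≤ H.dist ρ x + w.length := by
  obtain ⟨w', hw⟩ := hr.exists_walk_length_eq_dist
  rw [← hw]
  simpa using H.dist_le (w'.append w)

/-- A step of size one changes the block only between residues m − 1 and 0, and residue m − 1 is
forbidden. -/
theorem div_eq_div_of_mod_ne {m x y : ℕ} (hm : 0 < m) (h1 : x ≤ y + 1) (h2 : y ≤ x + 1)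
    (hx : x % m ≠ m - 1) (hy : y % m ≠ m - 1) : x / m = y / m := by
  have key : ∀ x, x % m ≠ m - 1 → (x + 1) / m = x / m := fun x hx => by
    rw [Nat.succ_div, if_neg, add_zero]
    intro hd
    apply hx
    have h1 := Nat.mod_lt x hm
    have h2 : (x % m + 1) % m = 0 := by
      rw [Nat.mod_add_mod]; exact Nat.mod_eq_zero_of_dvd hd
    by_contra hne
    rw [Nat.mod_eq_of_lt (by omega)] at h2
    omega
  rcases Nat.lt_trichotomy x y with h | h | h
  · obtain rfl : y = x + 1 := by omega
    exact (key x hx).symm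
  · rw [h]
  · obtain rfl : x = y + 1 := by omega
    exact key y hy

theorem exists_isChop [Finite V] (H : SimpleGraph V) {m : ℕ} (hm : 0 < m) :
    ∃ Y : ℕ → Set V, (∀ v, ∃! c, c < m ∧ v ∈ Y c) ∧ ∀ c < m, IsChop H (H.isolate (Y c)) m := by
  classical
  let r : V → V := fun v => (H.connectedComponentMk v).out
  have hr : ∀ v, H.Reachable (r v) v := fun v =>
    ConnectedComponent.exact (Quot.out_eq (H.connectedComponentMk v))
  have hrr : ∀ u v, H.Reachable u v → r u = r v := fun u v h => by
    simp only [r, ConnectedComponent.sound h]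
  let d : V → ℕ := fun v => H.dist (r v) v
  refine ⟨fun c => {v | d v % m = c}, fun v => ⟨d v % m, ⟨Nat.mod_lt _ hm, rfl⟩, fun c h => h.2.symm⟩,
    fun c hc => ⟨isolate_le _ _, ?_⟩⟩
  rintro v ⟨y₀, hy₀⟩
  set Y : Set V := {v | d v % m = c}
  -- Shifted levels: the cut levels get residue m − 1, so each annulus lies in a single block `e /
  -- m`.
  let e : V → ℕ := fun y => d y + (m - 1 - c)
  have heY : ∀ y, y ∈ Y ↔ e y % m = m - 1 := fun y => by
    have h1 := Nat.div_add_mod (d y) m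
    have h2 := Nat.mod_lt (d y) hm
    change d y % m = c ↔ (d y + (m - 1 - c)) % m = m - 1
    constructor
    · intro h
      rw [← Nat.mod_add_mod, h, show c + (m - 1 - c) = m - 1 by omega, Nat.mod_eq_of_lt (by omega)]
    · intro h
      rw [← Nat.mod_add_mod] at h
      by_cases hl : d y % m + (m - 1 - c) < m
      · rw [Nat.mod_eq_of_lt hl] at h; omega
      · rw [Nat.mod_eq_sub_mod (by omega), Nat.mod_eq_of_lt (by omega)] at h; omega
  have hreach : ∀ y, (H.isolate Y).Reachable v y → y ∉ Y ∧ e y / m = e v / m ∧ r y = r v := by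
    intro y hy
    obtain ⟨w⟩ := hy.symm
    have hv : v ∉ Y := hy₀.2.1
    clear hy₀
    induction w with
    | nil => exact ⟨hv, rfl, rfl⟩
    | @cons y z v h w ih =>
      obtain ⟨h1, h2, h3⟩ := ih ⟨w.reverse⟩ hv
      have hyz := hrr _ _ h.1.reachable
      refine ⟨h.2.1, h2 ▸ ?_, hyz.trans h3⟩
      have e1 := (hr y).dist_le_succ h.1
      have e2 := (hr z).dist_le_succ h.1.symm
      rw [hyz] at e1
      rw [← hyz] at e2
      refine div_eq_div_of_mod_ne hm ?_ ?_ (mt (heY y).2 h.2.1) (mt (heY z).2 h1)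
      · change H.dist _ _ + _ ≤ H.dist _ _ + _ + 1
        rw [hyz] at e2 ⊢; omega
      · change H.dist _ _ + _ ≤ H.dist _ _ + _ + 1
        rw [hyz] ; omega
  -- The start of the block, shifted back. The subtraction truncates to 0 in the block around the
  -- root, where 0 is the correct start of the window.
  refine ⟨r v, m * (e v / m) - (m - 1 - c), hr v, fun y hy => ?_, fun u z w hu hw => ?_⟩
  · obtain ⟨h1, h2, h3⟩ := hreach y hy
    have h4 := Nat.div_add_mod (e y) m
    have h5 := Nat.mod_lt (e y) hm
    have h6 := mt (heY y).2 h1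
    rw [← h3, ← h2]
    change _ ≤ d y ∧ d y < _
    change m * (e y / m) + e y % m = d y + (m - 1 - c) at h4
    omega
  · refine w.exists_isolate fun y hy => ?_
    obtain ⟨h1, h2, h3⟩ := hreach u hu
    have hyv : r y = r v := (hrr _ _ ⟨w.takeUntil y hy⟩).symm.trans h3
    have hy' := hw y hy
    rw [heY]
    have hd1 : H.dist (r v) y = d y := by rw [← hyv]
    have hd2 : H.dist (r v) u = d u := by rw [← h3]
    rw [hd1, hd2] at hy'
    have h4 := Nat.div_add_mod (e u) m
    have h5 := Nat.mod_lt (e u) hm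
    have h6 := mt (heY u).2 h1
    have hey : e y = d y + (m - 1 - c) := rfl
    have heu : e u = d u + (m - 1 - c) := rfl
    rw [h2] at h4
    have h7 : m * (e v / m) ≤ e y := by omega
    obtain ⟨k, hk⟩ := Nat.exists_eq_add_of_le h7
    rw [hk, Nat.mul_add_mod, Nat.mod_eq_of_lt (by omega)]
    omega

/-- From `v` one can descend along a breadth-first tree by `k` levels. -/
theorem exists_descent {H : SimpleGraph V} {ρ : V} (k : ℕ) : ∀ v : V, H.Reachable ρ v →
    k ≤ H.dist ρ v → ∃ (u : V) (w : H.Walk v u), H.dist ρ u + k = H.dist ρ v ∧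
      ∀ y ∈ w.support, H.dist ρ y ≤ H.dist ρ v ∧ H.dist ρ v ≤ H.dist ρ y + k ∧
        ∃ w' : H.Walk v y, w'.length + H.dist ρ y = H.dist ρ v ∧
          ∀ z ∈ w'.support, H.dist ρ y ≤ H.dist ρ z ∧ H.dist ρ z ≤ H.dist ρ v := by
  induction k with
  | zero =>
    intro v hv _
    refine ⟨v, .nil, rfl, fun y hy => ?_⟩
    obtain rfl : y = v := by simpa using hy
    exact ⟨le_rfl, le_rfl, .nil, by simp, by simp⟩
  | succ k ih =>
    intro v hv hk
    obtain ⟨x, hx, hxd⟩ : ∃ x, H.Adj v x ∧ H.dist ρ x + 1 = H.dist ρ v := by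
      obtain ⟨w, hw⟩ := hv.symm.exists_walk_length_eq_dist
      cases w with
      | nil => simp at hk
      | @cons _ x _ h w =>
        refine ⟨x, h, le_antisymm ?_ ?_⟩
        · rw [H.dist_comm, H.dist_comm (u := ρ), ← hw]
          simpa using H.dist_le w
        · exact (hv.trans h.reachable).dist_le_succ h.symm
    obtain ⟨u, w, hu, hw⟩ := ih x (hv.trans hx.reachable) (by omega)
    refine ⟨u, .cons hx w, by omega, fun y hy => ?_⟩
    rw [Walk.support_cons, List.mem_cons] at hy
    rcases hy with rfl | hy
    · exact ⟨le_rfl, by omega, .nil, by simp, by simp⟩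
    · obtain ⟨h1, h2, w', h3, h4⟩ := hw y hy
      refine ⟨by omega, by omega, .cons hx w', by simp; omega, fun z hz => ?_⟩
      rw [Walk.support_cons, List.mem_cons] at hz
      rcases hz with rfl | hz
      · omega
      · have := h4 z hz; omega

end SimpleGraph

/-! ### Three rounds of cutting in a planar graph -/

namespace SimpleGraph

variable {V : Type*}

theorem Walk.exists_mapLe {H G : SimpleGraph V} (h : H ≤ G) {u v : V} (w : H.Walk u v) :
    ∃ w' : G.Walk u v, w'.length = w.length ∧ w'.support = w.support :=
  ⟨w.mapLe h, by simp, by simp⟩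

/-- The walks from a vertex `v` of an iterated annulus to the three breadth-first roots. Every
vertex of the `i`-th walk is in the `i`-th root region or near `v` and outside of the other two
root regions. -/
theorem exists_walks_to_roots {G H₁ H₂ H₃ : SimpleGraph V} {m : ℕ} {v₀ ρ₁ ρ₂ ρ₃ : V}
    {a₁ a₂ a₃ : ℕ} (hG₁ : H₁ ≤ G) (h₁₂ : H₂ ≤ H₁) (h₂₃ : H₃ ≤ H₂)
    (hr₁ : G.Reachable ρ₁ v₀) (hr₂ : H₁.Reachable ρ₂ v₀) (hr₃ : H₂.Reachable ρ₃ v₀)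
    (hw₁ : ∀ y, H₁.Reachable v₀ y → a₁ ≤ G.dist ρ₁ y ∧ G.dist ρ₁ y < a₁ + m)
    (hw₂ : ∀ y, H₂.Reachable v₀ y → a₂ ≤ H₁.dist ρ₂ y ∧ H₁.dist ρ₂ y < a₂ + m)
    (hw₃ : ∀ y, H₃.Reachable v₀ y → a₃ ≤ H₂.dist ρ₃ y ∧ H₂.dist ρ₃ y < a₃ + m)
    (hl₁ : ∀ (u z : V) (w : G.Walk u z), H₁.Reachable v₀ u →
      (∀ y ∈ w.support, a₁ ≤ G.dist ρ₁ y ∧ G.dist ρ₁ y ≤ G.dist ρ₁ u) →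
      ∃ w' : H₁.Walk u z, w'.length = w.length)
    (hl₂ : ∀ (u z : V) (w : H₁.Walk u z), H₂.Reachable v₀ u →
      (∀ y ∈ w.support, a₂ ≤ H₁.dist ρ₂ y ∧ H₁.dist ρ₂ y ≤ H₁.dist ρ₂ u) →
      ∃ w' : H₂.Walk u z, w'.length = w.length)
    (ha₂ : m + 2 ≤ a₂) (ha₃ : m + 2 ≤ a₃)
    {X₁ X₂ X₃ : Set V} (hX₁ : X₁ = {y | G.dist ρ₁ y < a₁})
    (hX₂ : X₂ = {y | H₁.Reachable v₀ y ∧ H₁.dist ρ₂ y < a₂ - 2 * m - 3})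
    (hX₃ : X₃ = {y | H₂.Reachable v₀ y ∧ H₂.dist ρ₃ y < a₃ - 2 * m - 3})
    {v : V} (hv : H₃.Reachable v₀ v) :
    (∃ w : G.Walk v ρ₁, ∀ y ∈ w.support, y ∈ X₁ ∨
      (∃ s : G.Walk v y, s.length ≤ 5 * m + 5) ∧ y ∉ X₂ ∧ y ∉ X₃) ∧
    (∃ w : G.Walk v ρ₂, ∀ y ∈ w.support, y ∈ X₂ ∨
      (∃ s : G.Walk v y, s.length ≤ 5 * m + 5) ∧ y ∉ X₁ ∧ y ∉ X₃) ∧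
    (∃ w : G.Walk v ρ₃, ∀ y ∈ w.support, y ∈ X₃ ∨
      (∃ s : G.Walk v y, s.length ≤ 5 * m + 5) ∧ y ∉ X₁ ∧ y ∉ X₂) := by
  have hG₂ := h₁₂.trans hG₁
  have hv₂ : H₂.Reachable v₀ v := hv.mono h₂₃
  have hroot : ∀ {H : SimpleGraph V} {ρ y : V}, H.Reachable ρ y → H.dist ρ y = 0 → ρ = y :=
    fun h h0 => h.dist_eq_zero_iff.1 h0
  have nX₁ : ∀ y, H₁.Reachable v₀ y → y ∉ X₁ := fun y hy h => by
    rw [hX₁] at h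
    have := hw₁ y hy
    change G.dist ρ₁ y < a₁ at h
    omega
  have nX₂ : ∀ y, H₁.Reachable v₀ y → a₂ ≤ H₁.dist ρ₂ y + (2 * m + 3) → y ∉ X₂ :=
    fun y hy hd h => by
    rw [hX₂] at h
    have := h.2
    omega
  have nX₃ : ∀ y, H₂.Reachable v₀ y → a₃ ≤ H₂.dist ρ₃ y + (2 * m + 3) → y ∉ X₃ :=
    fun y hy hd h => by
    rw [hX₃] at h
    have := h.2
    omega
  have nX₃' : ∀ y, ¬ H₂.Reachable v₀ y → y ∉ X₃ := fun y hy h => by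
    rw [hX₃] at h
    exact hy h.1
  have e3 := hw₃ v hv
  -- descent in the innermost graph
  obtain ⟨u3, A, hu3, hA⟩ := exists_descent (H := H₂) (ρ := ρ₃) (H₂.dist ρ₃ v - (a₃ - m - 2)) v
    (hr₃.trans hv₂) (by omega)
  have hu3₂ : H₂.Reachable v₀ u3 := hv₂.trans ⟨A⟩
  have e2 := hw₂ u3 hu3₂
  -- The level a₂ − m − 2 is so low that fewer than m further steps in `H₁` stay below a₂, hence
  -- outside the component of `v₀` in `H₂`, and so high that they do not reach `X₂`. Since levels in
  -- the window are below a₂ + m, this descent has at most 2m + 1 steps.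
  obtain ⟨u2, B, hu2, hB⟩ := exists_descent (H := H₁) (ρ := ρ₂) (H₁.dist ρ₂ u3 - (a₂ - m - 2)) u3
    (hr₂.trans (hu3₂.mono h₁₂)) (by omega)
  have hu2₁ : H₁.Reachable v₀ u2 := (hu3₂.mono h₁₂).trans ⟨B⟩
  have e1 := hw₁ u2 hu2₁
  obtain ⟨A', -, hA'⟩ := A.exists_mapLe hG₂
  obtain ⟨B', -, hB'⟩ := B.exists_mapLe hG₁
  have segA : ∀ y ∈ A'.support, H₂.Reachable v₀ y ∧ a₃ ≤ H₂.dist ρ₃ y + (m + 2) ∧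
      ∃ s : G.Walk v y, s.length ≤ 2 * m + 2 := fun y hy => by
    rw [hA'] at hy
    obtain ⟨h1, h2, w', h3, -⟩ := hA y hy
    obtain ⟨s, hs, -⟩ := w'.exists_mapLe hG₂
    exact ⟨hv₂.trans ⟨w'⟩, by omega, s, by omega⟩
  obtain ⟨-, -, sA, hsA⟩ := segA u3 A'.end_mem_support
  -- vertices reached from `u3` by breadth-first descent in `H₁`
  have segB : ∀ y, ∀ w' : H₁.Walk u3 y, w'.length + H₁.dist ρ₂ y = H₁.dist ρ₂ u3 →
      (∀ z ∈ w'.support, H₁.dist ρ₂ y ≤ H₁.dist ρ₂ z ∧ H₁.dist ρ₂ z ≤ H₁.dist ρ₂ u3) →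
      y ∈ X₂ ∨ (∃ s : G.Walk v y, s.length ≤ 5 * m + 5) ∧ y ∉ X₁ ∧ y ∉ X₃ := by
    intro y w' hl hz
    have hy₁ : H₁.Reachable v₀ y := (hu3₂.mono h₁₂).trans ⟨w'⟩
    by_cases hy : H₁.dist ρ₂ y < a₂ - 2 * m - 3
    · left; rw [hX₂]; exact ⟨hy₁, hy⟩
    right
    obtain ⟨s, hs, -⟩ := w'.exists_mapLe hG₁
    refine ⟨⟨sA.append s, ?_⟩, nX₁ y hy₁, ?_⟩
    · rw [Walk.length_append]; omega
    -- While the descent stays at level a₂ or above it survives in `H₂` and has fewer than m steps,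
    -- too few to get from `u3`, at level a₃ − m − 2, into `X₃`. Below a₂ it is outside the
    -- `H₂`-component that contains `X₃`.
    by_cases hya : a₂ ≤ H₁.dist ρ₂ y
    · obtain ⟨w'', hw''⟩ := hl₂ u3 y w' hu3₂ fun z hz' => ⟨hya.trans (hz z hz').1, (hz z hz').2⟩
      have hy₂ : H₂.Reachable v₀ y := hu3₂.trans ⟨w''⟩
      refine nX₃ y hy₂ ?_
      have := (hr₃.trans hy₂).dist_le_add_length w''.reverse
      rw [Walk.length_reverse] at this
      omega
    · exact nX₃' y fun h => hya (hw₂ y h).1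
  refine ⟨?_, ?_, ?_⟩
  · obtain ⟨z, C, hz, hC⟩ := exists_descent (H := G) (ρ := ρ₁) (G.dist ρ₁ u2) u2
      (hr₁.trans (hu2₁.mono hG₁)) le_rfl
    obtain rfl : ρ₁ = z := hroot (hr₁.trans ((hu2₁.mono hG₁).trans ⟨C⟩)) (by omega)
    refine ⟨(A'.append B').append C, fun y hy => ?_⟩
    rw [Walk.mem_support_append_iff, Walk.mem_support_append_iff] at hy
    have nB : ∀ y ∈ B'.support, H₁.Reachable v₀ y ∧ (∃ s : G.Walk v y, s.length ≤ 4 * m + 4) ∧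
        y ∉ X₂ ∧ y ∉ X₃ := fun y hy => by
      rw [hB'] at hy
      obtain ⟨h1, h2, w', h3, h4⟩ := hB y hy
      have hy₁ : H₁.Reachable v₀ y := (hu3₂.mono h₁₂).trans ⟨w'⟩
      have hyX : y ∉ X₂ := nX₂ y hy₁ (by omega)
      obtain ⟨s, hs, -⟩ := w'.exists_mapLe hG₁
      refine ⟨hy₁, ⟨sA.append s, by rw [Walk.length_append]; omega⟩, hyX,
        ((segB y w' h3 h4).resolve_left hyX).2.2⟩
    rcases hy with (hy | hy) | hy
    · obtain ⟨h1, h2, s, hs⟩ := segA y hy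
      have := hw₂ y h1
      exact Or.inr ⟨⟨s, by omega⟩, nX₂ y (h1.mono h₁₂) (by omega), nX₃ y h1 (by omega)⟩
    · obtain ⟨-, ⟨s, hs⟩, h2⟩ := nB y hy
      exact Or.inr ⟨⟨s, by omega⟩, h2⟩
    · obtain ⟨h1, h2, w', h3, h4⟩ := hC y hy
      by_cases hya : G.dist ρ₁ y < a₁
      · left; rw [hX₁]; exact hya
      right
      obtain ⟨-, ⟨s, hs⟩, -⟩ := nB u2 B'.end_mem_support
      refine ⟨⟨s.append w', by rw [Walk.length_append]; omega⟩, ?_⟩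
      obtain ⟨w'', hw''⟩ := hl₁ u2 y w' hu2₁ fun z hz' => ⟨by have := h4 z hz'; omega, (h4 z hz').2⟩
      have hy₁ : H₁.Reachable v₀ y := hu2₁.trans ⟨w''⟩
      have e4 := (hr₂.trans hy₁).dist_le_add_length w''.reverse
      have e5 := (hr₂.trans hu2₁).dist_le_add_length w''
      rw [Walk.length_reverse] at e4
      refine ⟨nX₂ y hy₁ (by omega), nX₃' y fun h => ?_⟩
      have := hw₂ y h
      omega
  · obtain ⟨z, C, hz, hC⟩ := exists_descent (H := H₁) (ρ := ρ₂) (H₁.dist ρ₂ u3) u3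
      (hr₂.trans (hu3₂.mono h₁₂)) le_rfl
    obtain rfl : ρ₂ = z := hroot (hr₂.trans ((hu3₂.mono h₁₂).trans ⟨C⟩)) (by omega)
    obtain ⟨C', -, hC'⟩ := C.exists_mapLe hG₁
    refine ⟨A'.append C', fun y hy => ?_⟩
    rw [Walk.mem_support_append_iff, hC'] at hy
    rcases hy with hy | hy
    · obtain ⟨h1, h2, s, hs⟩ := segA y hy
      exact Or.inr ⟨⟨s, by omega⟩, nX₁ y (h1.mono h₁₂), nX₃ y h1 (by omega)⟩
    · obtain ⟨-, -, w', h3, h4⟩ := hC y hy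
      exact segB y w' h3 h4
  · obtain ⟨z, C, hz, hC⟩ := exists_descent (H := H₂) (ρ := ρ₃) (H₂.dist ρ₃ v) v
      (hr₃.trans hv₂) le_rfl
    obtain rfl : ρ₃ = z := hroot (hr₃.trans (hv₂.trans ⟨C⟩)) (by omega)
    obtain ⟨C', -, hC'⟩ := C.exists_mapLe hG₂
    refine ⟨C', fun y hy => ?_⟩
    rw [hC'] at hy
    obtain ⟨-, -, w', h3, -⟩ := hC y hy
    have hy₂ : H₂.Reachable v₀ y := hv₂.trans ⟨w'⟩
    have := hw₂ y hy₂
    by_cases hy3 : H₂.dist ρ₃ y < a₃ - 2 * m - 3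
    · left; rw [hX₃]; exact ⟨hy₂, hy3⟩
    · obtain ⟨s, hs, -⟩ := w'.exists_mapLe hG₂
      exact Or.inr ⟨⟨s, by omega⟩, nX₁ y (hy₂.mono h₁₂), nX₂ y (hy₂.mono h₁₂) (by omega)⟩

/-- Three rounds of chopping leave no three vertices far apart in one component of a planar
graph. -/
theorem _root_.IsPlanar.exists_short_walk {G H₁ H₂ H₃ : SimpleGraph V} (hG : IsPlanar G) {m : ℕ}
    (h₁ : IsChop G H₁ m) (h₂ : IsChop H₁ H₂ m) (h₃ : IsChop H₂ H₃ m) (v : Fin 3 → V)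
    (hv : ∀ k, H₃.Reachable (v 0) (v k)) (hadj : ∃ y, H₃.Adj (v 0) y) :
    ∃ k l, k ≠ l ∧ ∃ w : G.Walk (v k) (v l), w.length ≤ 10 * m + 10 := by
  by_contra! hfar
  obtain ⟨y, hy⟩ := hadj
  obtain ⟨ρ₁, a₁, hr₁, hw₁, hl₁⟩ := h₁.2 (v 0) ⟨y, h₂.1 (h₃.1 hy)⟩
  obtain ⟨ρ₂, a₂, hr₂, hw₂, hl₂⟩ := h₂.2 (v 0) ⟨y, h₃.1 hy⟩
  obtain ⟨ρ₃, a₃, hr₃, hw₃, -⟩ := h₃.2 (v 0) ⟨y, hy⟩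
  have hle₁ := h₁.1
  have hle₂ := h₂.1
  have hle₃ := h₃.1
  -- if a window starts close to the root, all vertices are close to the root
  have hclose : ∀ (H : SimpleGraph V) (ρ : V), H ≤ G → (∀ k, H.Reachable ρ (v k)) →
      ∃ k, 2 * m + 2 ≤ H.dist ρ (v k) := fun H ρ hH hr => by
    by_contra! hlt
    obtain ⟨w, hw⟩ := (hr 0).exists_walk_length_eq_dist
    obtain ⟨w', hw'⟩ := (hr 1).exists_walk_length_eq_dist
    obtain ⟨s, hs, -⟩ := (w.reverse.append w').exists_mapLe hH
    have := hfar 0 1 (by decide) s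
    have h0 := hlt 0
    have h1 := hlt 1
    rw [hs, Walk.length_append, Walk.length_reverse] at this
    omega
  have ha₂ : m + 2 ≤ a₂ := by
    obtain ⟨k, hk⟩ := hclose H₁ ρ₂ hle₁ fun k => hr₂.trans (((hv k).mono hle₃).mono hle₂)
    have := hw₂ (v k) ((hv k).mono hle₃)
    omega
  have ha₃ : m + 2 ≤ a₃ := by
    obtain ⟨k, hk⟩ := hclose H₂ ρ₃ (hle₂.trans hle₁) fun k => hr₃.trans ((hv k).mono hle₃)
    have := hw₃ (v k) (hv k)
    omega
  -- The root regions are disjoint: each later region lies in a component whose levels in every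
  -- earlier search are inside the window, and the earlier region lies below that window.
  set X : Fin 3 → Set V := ![{y | G.dist ρ₁ y < a₁},
    {y | H₁.Reachable (v 0) y ∧ H₁.dist ρ₂ y < a₂ - 2 * m - 3},
    {y | H₂.Reachable (v 0) y ∧ H₂.dist ρ₃ y < a₃ - 2 * m - 3}] with hX
  have hXd : ∀ i j, i < j → ∀ y, y ∈ X i → y ∉ X j := by
    have d1 : ∀ y, y ∈ X 0 → y ∉ X 1 := fun y h0 h1 => by
      change G.dist ρ₁ y < a₁ at h0
      have := hw₁ y h1.1
      omega
    have d2 : ∀ y, y ∈ X 0 → y ∉ X 2 := fun y h0 h1 => by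
      change G.dist ρ₁ y < a₁ at h0
      have := hw₁ y (h1.1.mono hle₂)
      omega
    have d3 : ∀ y, y ∈ X 1 → y ∉ X 2 := fun y h0 h1 => by
      have h0 := h0.2
      have := hw₂ y h1.1
      omega
    intro i j hij
    fin_cases i <;> fin_cases j <;> first | exact absurd hij (by decide) | assumption
  have hXd' : ∀ i j, i ≠ j → ∀ y, y ∈ X i → y ∉ X j := fun i j hij y hi hj => by
    rcases lt_or_gt_of_ne hij with h | h
    · exact hXd i j h y hi hj
    · exact hXd j i h y hj hi
  have hW : ∀ k i, ∃ w : G.Walk (v k) (![ρ₁, ρ₂, ρ₃] i), ∀ y ∈ w.support, y ∈ X i ∨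
      (∃ s : G.Walk (v k) y, s.length ≤ 5 * m + 5) ∧ ∀ j, j ≠ i → y ∉ X j := by
    intro k
    obtain ⟨⟨w₁, p₁⟩, ⟨w₂, p₂⟩, ⟨w₃, p₃⟩⟩ := exists_walks_to_roots hle₁ hle₂ hle₃ hr₁ hr₂ hr₃ hw₁
      hw₂ hw₃ hl₁ hl₂ ha₂ ha₃ (X₁ := X 0) (X₂ := X 1) (X₃ := X 2) rfl rfl rfl (hv k)
    intro i
    fin_cases i
    · refine ⟨w₁, fun y hy => (p₁ y hy).imp_right fun h => ⟨h.1, fun j hj => ?_⟩⟩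
      fin_cases j
      · exact absurd rfl hj
      · exact h.2.1
      · exact h.2.2
    · refine ⟨w₂, fun y hy => (p₂ y hy).imp_right fun h => ⟨h.1, fun j hj => ?_⟩⟩
      fin_cases j
      · exact h.2.1
      · exact absurd rfl hj
      · exact h.2.2
    · refine ⟨w₃, fun y hy => (p₃ y hy).imp_right fun h => ⟨h.1, fun j hj => ?_⟩⟩
      fin_cases j
      · exact h.2.1
      · exact h.2.2
      · exact absurd rfl hj
  choose W hW using hW
  -- A common vertex of two such walks lies in neither of their root regions, so it is within 5m + 5
  -- steps of both `v k` and `v l`; this contradicts their distance.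
  refine hG.not_exists_K33 v ![ρ₁, ρ₂, ρ₃] W fun k l i j hkl hij y hy hy' => ?_
  rcases hW k i y hy with h1 | ⟨⟨s, hs⟩, h1⟩ <;> rcases hW l j y hy' with h2 | ⟨⟨s', hs'⟩, h2⟩
  · exact hXd' i j hij y h1 h2
  · exact h2 i hij h1
  · exact h1 j hij.symm h2
  · have := hfar k l hkl (s.append s'.reverse)
    rw [Walk.length_append, Walk.length_reverse] at this
    omega

end SimpleGraph

/-! ### Weighted hyperfiniteness of planar graphs -/

/-- Up to a set `Y` of small measure, the graphs of `𝒢` fall apart into pieces of bounded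
diameter, for all probability distributions on their vertices. -/
def WeightedHyperfinite (𝒢 : Set FinGraph) : Prop :=
  ∀ ε : ℝ, 0 < ε → ∃ R : ℕ, ∀ G ∈ 𝒢, ∀ p : G.V → ℝ, (∀ v, 0 < p v) → ∑ v, p v = 1 →
    ∃ (Y : Finset G.V) (s : Setoid G.V), ∑ v ∈ Y, p v ≤ ε ∧
      (∀ x y, G.graph.Adj x y → x ∉ Y → y ∉ Y → s x y) ∧
      ∀ x y, x ∉ Y → y ∉ Y → s x y → y ∈ G.ball x R

namespace SimpleGraph

-- The m possible cuts partition the vertices, so the lightest has measure at most 1/m.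
open Classical in
theorem exists_isChop_sum_le {V : Type*} [Fintype V] (H : SimpleGraph V) {m : ℕ} (hm : 0 < m)
    (p : V → ℝ) (hp : ∑ v, p v = 1) :
    ∃ Y : Finset V, IsChop H (H.isolate Y) m ∧ ∑ v ∈ Y, p v ≤ 1 / m := by
  obtain ⟨Y, hY, hc⟩ := exists_isChop H hm
  have hsum : ∑ c ∈ Finset.range m, ∑ v with v ∈ Y c, p v = 1 := by
    simp_rw [Finset.sum_filter]
    rw [Finset.sum_comm, ← hp]
    refine Finset.sum_congr rfl fun v _ => ?_
    obtain ⟨c, ⟨h1, h2⟩, h3⟩ := hY v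
    rw [Finset.sum_eq_single_of_mem c (Finset.mem_range.2 h1), if_pos h2]
    intro b hb hbc
    exact if_neg fun h => hbc (h3 b ⟨Finset.mem_range.1 hb, h⟩)
  obtain ⟨c, hcm, hle⟩ := Finset.exists_le_of_sum_le (s := Finset.range m)
    (f := fun c => ∑ v with v ∈ Y c, p v) (g := fun _ => (1 : ℝ) / m)
    (Finset.nonempty_range_iff.2 hm.ne') (by
      rw [hsum, Finset.sum_const, Finset.card_range, nsmul_eq_mul]
      have : (m : ℝ) ≠ 0 := by positivity
      rw [mul_one_div_cancel this])
  refine ⟨Finset.univ.filter fun v => v ∈ Y c, ?_, hle⟩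
  simpa using hc c (Finset.mem_range.1 hcm)

/-- Discrete intermediate values: the `G`-distance from x grows by at most one per step of an
`H`-walk. -/
theorem Walk.exists_edist_eq {V : Type*} {H G : SimpleGraph V} (hHG : H ≤ G) {x y : V}
    (w : H.Walk x y) (n : ℕ) (hn : (n : ℕ∞) ≤ G.edist x y) :
    ∃ z, H.Reachable x z ∧ G.edist x z = n := by
  induction w using Walk.concatRec with
  | Hnil =>
    refine ⟨_, Reachable.refl _, ?_⟩
    rw [edist_self] at hn ⊢
    exact (le_antisymm hn bot_le).symm
  | @Hconcat x y z p h ih =>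
    by_cases hy : (n : ℕ∞) ≤ G.edist x y
    · exact ih hy
    refine ⟨z, ⟨p.concat h⟩, le_antisymm ?_ hn⟩
    have h1 : G.edist x z ≤ G.edist x y + 1 :=
      G.edist_triangle.trans (by gcongr; exact (edist_eq_one_iff_adj.2 (hHG h)).le)
    exact h1.trans (Order.add_one_le_of_lt (not_le.1 hy))

end SimpleGraph

open Classical in
/-- Klein, Plotkin and Rao: planar graphs are weighted hyperfinite. -/
theorem weightedHyperfinite_planar : WeightedHyperfinite {G | IsPlanar G.graph} := by
  intro ε hε
  obtain ⟨m, hm⟩ := exists_nat_gt (3 / ε)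
  have hm0' : (0 : ℝ) < m := (by positivity : (0 : ℝ) < 3 / ε).trans hm
  have hm0 : 0 < m := by exact_mod_cast hm0'
  refine ⟨20 * m + 21, fun G hG p hp hp1 => ?_⟩
  obtain ⟨Y₁, c₁, hY₁⟩ := G.graph.exists_isChop_sum_le hm0 p hp1
  obtain ⟨Y₂, c₂, hY₂⟩ := (G.graph.isolate Y₁).exists_isChop_sum_le hm0 p hp1
  obtain ⟨Y₃, c₃, hY₃⟩ := ((G.graph.isolate Y₁).isolate Y₂).exists_isChop_sum_le hm0 p hp1
  set H := ((G.graph.isolate Y₁).isolate Y₂).isolate Y₃ with hH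
  refine ⟨Y₁ ∪ Y₂ ∪ Y₃, H.reachableSetoid, ?_, ?_, ?_⟩
  · have hu : ∀ A B : Finset G.V, ∑ v ∈ A ∪ B, p v ≤ ∑ v ∈ A, p v + ∑ v ∈ B, p v := fun A B => by
      rw [← Finset.sum_union_inter]
      exact le_add_of_nonneg_right (Finset.sum_nonneg fun v _ => (hp v).le)
    have h3 : (3 : ℝ) / m ≤ ε := by
      rw [div_lt_iff₀ hε] at hm
      rw [div_le_iff₀ hm0']; linarith
    have e : (3 : ℝ) / m = 1 / m + 1 / m + 1 / m := by ring
    linarith [hu (Y₁ ∪ Y₂) Y₃, hu Y₁ Y₂]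
  · intro x y hxy hx hy
    simp only [Finset.mem_union, not_or] at hx hy
    have : H.Adj x y := by
      simp [hH, SimpleGraph.isolate, hxy, hx, hy]
    exact this.reachable
  · intro x y _ _ hxy
    by_contra hfar
    have hfar : ((20 * m + 21 : ℕ) : ℕ∞) < G.graph.edist x y := not_le.1 hfar
    have hHG : H ≤ G.graph := c₃.1.trans (c₂.1.trans c₁.1)
    obtain ⟨w⟩ : H.Reachable x y := hxy
    -- A third vertex of the component at distance exactly 10m + 11 from x. As y is farther than 20m
    -- + 21 = (10m + 11) + (10m + 10) from x, the three are pairwise more than 10m + 10 apart.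
    obtain ⟨z, hz, hxz⟩ := w.exists_edist_eq hHG (10 * m + 11) (le_trans (by
      exact_mod_cast (by omega : 10 * m + 11 ≤ 20 * m + 21)) hfar.le)
    have hadj : ∃ y, H.Adj x y := by
      cases w with
      | nil => simp at hfar
      | cons h _ => exact ⟨_, h⟩
    obtain ⟨k, l, hkl, s, hs⟩ := IsPlanar.exists_short_walk hG c₁ c₂ c₃ ![x, z, y]
      (fun k => by
        fin_cases k
        · exact SimpleGraph.Reachable.refl _
        · exact hz
        · exact ⟨w⟩) hadj
    have key : G.graph.edist x z ≤ ((10 * m + 10 : ℕ) : ℕ∞) ∨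
        G.graph.edist x y ≤ ((10 * m + 10 : ℕ) : ℕ∞) ∨
        G.graph.edist z y ≤ ((10 * m + 10 : ℕ) : ℕ∞) := by
      have h1 : G.graph.edist (![x, z, y] k) (![x, z, y] l) ≤ ((10 * m + 10 : ℕ) : ℕ∞) :=
        (G.graph.edist_le s).trans (by exact_mod_cast hs)
      have h2 := h1
      rw [SimpleGraph.edist_comm] at h2
      fin_cases k <;> fin_cases l <;> first | exact absurd rfl hkl | skip
      · exact Or.inl h1
      · exact Or.inr (Or.inl h1)
      · exact Or.inl h2
      · exact Or.inr (Or.inr h1)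
      · exact Or.inr (Or.inl h2)
      · exact Or.inr (Or.inr h2)
    rcases key with h | h | h
    · rw [hxz] at h
      have : 10 * m + 11 ≤ 10 * m + 10 := by exact_mod_cast h
      omega
    · have := hfar.trans_le h
      have : 20 * m + 21 < 10 * m + 10 := by exact_mod_cast this
      omega
    · have h1 : G.graph.edist x y ≤ ((10 * m + 11 : ℕ) : ℕ∞) + ((10 * m + 10 : ℕ) : ℕ∞) :=
        G.graph.edist_triangle.trans (add_le_add hxz.le h)
      have := hfar.trans_le h1
      have : 20 * m + 21 < (10 * m + 11) + (10 * m + 10) := by exact_mod_cast this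
      omega

/-! ### Weighted hyperfiniteness from Property A -/

open MeasureTheory in
theorem integral_indicator_lt {a : ℝ} (h0 : 0 ≤ a) (h1 : a ≤ 1) :
    IntegrableOn (fun s : ℝ => if s < a then (1 : ℝ) else 0) (Set.Ico 0 1) ∧
      ∫ s in Set.Ico (0 : ℝ) 1, (if s < a then (1 : ℝ) else 0) = a := by
  have he : (fun s : ℝ => if s < a then (1 : ℝ) else 0) = (Set.Iio a).indicator fun _ => 1 := by
    funext s; simp [Set.indicator]
  rw [he]
  refine ⟨(integrable_const _).indicator measurableSet_Iio, ?_⟩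
  have hs : Set.Iio a ∩ Set.Ico 0 1 = Set.Ico 0 a := by
    ext s
    simp only [Set.mem_inter_iff, Set.mem_Iio, Set.mem_Ico]
    constructor
    · exact fun h => ⟨h.2.1, h.1⟩
    · exact fun h => ⟨h.2, h.1, h.2.trans_le h1⟩
  rw [integral_indicator measurableSet_Iio, Measure.restrict_restrict measurableSet_Iio, hs]
  simp [h0]

open MeasureTheory in
/-- Layer-cake comparison for a finite weighted family of numbers in `[0, 1]`. -/
theorem sum_nonpos_of_level_sets {ι : Type*} (A : Finset ι) (B : ι → Finset ι) (e c : ι → ℝ)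
    (a : ι → ℝ) (ha : ∀ i, 0 ≤ a i ∧ a i ≤ 1)
    (h : ∀ s : ℝ, 0 ≤ s → ∑ i ∈ A, (e i * (if s < a i then 1 else 0) - ∑ j ∈ B i,
      c i * ((if s < a i then 1 else 0) - if s < min (a i) (a j) then 1 else 0)) ≤ 0) :
    ∑ i ∈ A, (e i * a i - ∑ j ∈ B i, c i * (a i - min (a i) (a j))) ≤ 0 := by
  have hI : ∀ i, _ := fun i => integral_indicator_lt (ha i).1 (ha i).2
  have hm : ∀ i j, _ := fun i j => integral_indicator_lt (le_min (ha i).1 (ha j).1)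
    ((min_le_left _ (a j)).trans (ha i).2)
  have i1 : ∀ i, IntegrableOn (fun s => ∑ j ∈ B i, c i *
      ((if s < a i then (1 : ℝ) else 0) - if s < min (a i) (a j) then 1 else 0)) (Set.Ico 0 1) :=
    fun i => integrable_finsetSum _ fun j _ => ((hI i).1.sub (hm i j).1).const_mul _
  have key : ∫ s in Set.Ico (0 : ℝ) 1, ∑ i ∈ A, (e i * (if s < a i then 1 else 0) - ∑ j ∈ B i,
      c i * ((if s < a i then 1 else 0) - if s < min (a i) (a j) then 1 else 0)) =
      ∑ i ∈ A, (e i * a i - ∑ j ∈ B i, c i * (a i - min (a i) (a j))) := by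
    refine (integral_finsetSum _ fun i _ => ((hI i).1.const_mul (e i)).sub (i1 i)).trans
      (Finset.sum_congr rfl fun i _ => ?_)
    simp only [Pi.sub_apply]
    rw [integral_sub ((hI i).1.const_mul _) (i1 i), integral_const_mul, (hI i).2]
    congr 1
    refine (integral_finsetSum _ fun j _ => ((hI i).1.sub (hm i j).1).const_mul (c i)).trans
      (Finset.sum_congr rfl fun j _ => ?_)
    simp only [Pi.sub_apply]
    rw [integral_const_mul, integral_sub (hI i).1 (hm i j).1, (hI i).2, (hm i j).2]
  rw [← key]
  exact setIntegral_nonpos measurableSet_Ico fun s hs => h s hs.1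

open Classical in
/-- In a graph with Property A weights, every nonempty set of vertices contains a subset of bounded
diameter whose inner boundary has small relative measure. -/
theorem exists_small_boundary {G : FinGraph} {d S : ℕ} (hd : G.DegreeBounded d) {ε : ℝ}
    (hε : 0 < ε) {ρ : G.V → G.V → ℝ} (h0 : ∀ x z, 0 ≤ ρ x z) (h1 : ∀ x, ∑ z, ρ x z = 1)
    (hS : ∀ x z, ρ x z ≠ 0 → z ∈ G.ball x S)
    (hρ : ∀ x y, y ∈ G.ball x 1 → ∑ z, |ρ x z - ρ y z| ≤ ε / (d + 1))
    {p : G.V → ℝ} (hp : ∀ v, 0 < p v) {W : Finset G.V} (hW : W.Nonempty) :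
    ∃ U ⊆ W, U.Nonempty ∧ (∀ x ∈ U, ∀ y ∈ U, y ∈ G.ball x (2 * S)) ∧
      ∑ x ∈ U with ∃ y ∈ W \ U, G.graph.Adj x y, p x ≤ ε * ∑ x ∈ U, p x := by
  -- If the inner boundary of every level set {x ∈ W | s < ρ x z} had relative measure above ε,
  -- integration over s and summation over z would bound ε p(W) by the sum over x of p(x) times the
  -- ℓ¹-variations of ρ along the edges at x. At most d edges, each contributing at most ε/(d + 1),
  -- keep this strictly below ε p(W). A level set has diameter at most 2S because its points are
  -- within S of z.
  by_contra! hcon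
  have hle1 : ∀ x z, ρ x z ≤ 1 := fun x z => by
    rw [← h1 x]; exact Finset.single_le_sum (fun z _ => h0 x z) (Finset.mem_univ z)
  let N : G.V → Finset G.V := fun x => W.filter fun y => G.graph.Adj x y
  have hN : ∀ x, ((N x).card : ℝ) ≤ d := fun x => by
    have : (N x).card ≤ d := by
      refine le_trans ?_ (hd x)
      rw [← Set.ncard_coe_finset]
      exact Set.ncard_le_ncard (fun y hy => (Finset.mem_filter.1 hy).2) (Set.toFinite _)
    exact_mod_cast this
  have hz : ∀ z, ∑ x ∈ W, (ε * p x * ρ x z - ∑ y ∈ N x,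
      p x * (ρ x z - min (ρ x z) (ρ y z))) ≤ 0 := by
    intro z
    refine sum_nonpos_of_level_sets W N (fun x => ε * p x) p (fun x => ρ x z)
      (fun x => ⟨h0 x z, hle1 x z⟩) fun s hs => ?_
    set U := W.filter fun x => s < ρ x z with hU
    have hdiam : ∀ x ∈ U, ∀ y ∈ U, y ∈ G.ball x (2 * S) := by
      intro x hx y hy
      have hxz := hS x z (hs.trans_lt (Finset.mem_filter.1 hx).2).ne'
      have hyz := hS y z (hs.trans_lt (Finset.mem_filter.1 hy).2).ne'
      simp only [FinGraph.ball, Set.mem_ofPred_eq] at *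
      rw [SimpleGraph.edist_comm] at hyz
      calc _ ≤ _ := G.graph.edist_triangle (v := z)
        _ ≤ (S : ℕ∞) + S := add_le_add hxz hyz
        _ = _ := by push_cast; ring
    -- A boundary vertex has a neighbour in `W` outside the level set, and the term of that
    -- neighbour equals `p x`.
    have hb : ∑ x ∈ U with ∃ y ∈ W \ U, G.graph.Adj x y, p x ≤ ∑ x ∈ W, ∑ y ∈ N x,
        p x * ((if s < ρ x z then (1 : ℝ) else 0) - if s < min (ρ x z) (ρ y z) then 1 else 0) := by
      have hnn : ∀ x y, 0 ≤ p x * ((if s < ρ x z then (1 : ℝ) else 0) -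
          if s < min (ρ x z) (ρ y z) then 1 else 0) := fun x y => by
        refine mul_nonneg (hp x).le ?_
        have : s < min (ρ x z) (ρ y z) → s < ρ x z := fun h => h.trans_le (min_le_left _ _)
        split_ifs <;> simp_all
      refine (Finset.sum_le_sum fun x hx => ?_).trans (Finset.sum_le_sum_of_subset_of_nonneg
        ((Finset.filter_subset _ _).trans (Finset.filter_subset _ _))
        fun x _ _ => Finset.sum_nonneg fun y _ => hnn x y)
      obtain ⟨hxU, y, hy, hxy⟩ := Finset.mem_filter.1 hx
      rw [Finset.mem_sdiff] at hy
      have hsx : s < ρ x z := (Finset.mem_filter.1 hxU).2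
      have hsy : ¬ s < ρ y z := fun h => hy.2 (Finset.mem_filter.2 ⟨hy.1, h⟩)
      refine le_trans ?_ (Finset.single_le_sum (fun y _ => hnn x y)
        (Finset.mem_filter.2 ⟨hy.1, hxy⟩ : y ∈ N x))
      simp [hsx, hsy]
    have hUe : ∑ x ∈ W, ε * p x * (if s < ρ x z then 1 else 0) = ε * ∑ x ∈ U, p x := by
      simp_rw [mul_ite, mul_one, mul_zero]
      rw [← Finset.sum_filter, Finset.mul_sum]
    rw [Finset.sum_sub_distrib, hUe, sub_nonpos]
    refine le_trans ?_ hb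
    rcases U.eq_empty_or_nonempty with he | hne
    · simp [he]
    · exact (hcon U (Finset.filter_subset _ _) hne hdiam).le
  have hsum := Finset.sum_nonpos fun z (_ : z ∈ Finset.univ) => hz z
  rw [Finset.sum_comm] at hsum
  have hx : ∀ x ∈ W, 0 < ∑ z, (ε * p x * ρ x z - ∑ y ∈ N x,
      p x * (ρ x z - min (ρ x z) (ρ y z))) := by
    intro x _
    rw [Finset.sum_sub_distrib, ← Finset.mul_sum, h1, Finset.sum_comm, sub_pos]
    have hy : ∀ y ∈ N x, ∑ z, p x * (ρ x z - min (ρ x z) (ρ y z)) ≤ p x * (ε / (d + 1)) := by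
      intro y hy
      rw [← Finset.mul_sum]
      refine mul_le_mul_of_nonneg_left (le_trans (Finset.sum_le_sum fun z _ => ?_)
        (hρ x y ?_)) (hp x).le
      · rcases le_total (ρ x z) (ρ y z) with h | h
        · rw [min_eq_left h, sub_self]; exact abs_nonneg _
        · rw [min_eq_right h]; exact le_abs_self _
      · exact (SimpleGraph.edist_eq_one_iff_adj.2 (Finset.mem_filter.1 hy).2).le
    refine (Finset.sum_le_sum hy).trans_lt ?_
    rw [Finset.sum_const, nsmul_eq_mul, mul_one, mul_comm ε, ← mul_assoc, mul_comm _ (p x),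
      mul_assoc]
    refine mul_lt_mul_of_pos_left ?_ (hp x)
    rw [mul_div_assoc', div_lt_iff₀ (by positivity)]
    nlinarith [hN x]
  exact absurd hsum (not_le.2 (Finset.sum_pos hx hW))

open Classical in
theorem weightedHyperfinite_of_propertyA {d : ℕ} {𝒢 : Set FinGraph}
    (hd : ∀ G ∈ 𝒢, G.DegreeBounded d) (hA : PropertyA 𝒢) : WeightedHyperfinite 𝒢 := by
  intro ε hε
  obtain ⟨S, hS⟩ := hA 1 (ε / (d + 1)) (by positivity)
  refine ⟨2 * S, fun G hG p hp hp1 => ?_⟩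
  obtain ⟨ρ, h0, h1, hsupp, hρ⟩ := hS G hG
  have key : ∀ n : ℕ, ∀ W : Finset G.V, W.card ≤ n → ∃ (Y : Finset G.V) (c : G.V → ℕ),
      ∑ v ∈ Y, p v ≤ ε * ∑ v ∈ W, p v ∧ (∀ x ∈ W, c x ≤ n) ∧
      (∀ x ∈ W, ∀ y ∈ W, G.graph.Adj x y → x ∉ Y → y ∉ Y → c x = c y) ∧
      ∀ x ∈ W, ∀ y ∈ W, c x = c y → y ∈ G.ball x (2 * S) := by
    intro n
    induction n with
    | zero =>
      intro W hW
      obtain rfl : W = ∅ := by simpa using hW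
      exact ⟨∅, fun _ => 0, by simp⟩
    | succ n ih =>
      intro W hW
      rcases W.eq_empty_or_nonempty with rfl | hne
      · exact ⟨∅, fun _ => 0, by simp⟩
      obtain ⟨U, hUW, hU, hdiam, hb⟩ := exists_small_boundary (hd G hG) hε h0 h1 hsupp hρ hp hne
      obtain ⟨Y, c, i1, i2, i3, i4⟩ := ih (W \ U) (by
        have := Finset.card_sdiff_of_subset hUW
        have := hU.card_pos
        omega)
      set D := U.filter fun x => ∃ y ∈ W \ U, G.graph.Adj x y with hD
      have hDmem : ∀ x ∈ U, ∀ y ∈ W, y ∉ U → G.graph.Adj x y → x ∈ D := fun x hx y hy hyU hxy =>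
        Finset.mem_filter.2 ⟨hx, y, Finset.mem_sdiff.2 ⟨hy, hyU⟩, hxy⟩
      refine ⟨D ∪ Y, fun x => if x ∈ U then n + 1 else c x, ?_, fun x hx => ?_, ?_, ?_⟩
      · rw [← Finset.sum_sdiff hUW, mul_add]
        have : ∑ v ∈ D ∪ Y, p v ≤ ∑ v ∈ D, p v + ∑ v ∈ Y, p v := by
          rw [← Finset.sum_union_inter]
          exact le_add_of_nonneg_right (Finset.sum_nonneg fun v _ => (hp v).le)
        linarith
      · dsimp only
        split_ifs with h
        · exact le_rfl
        · exact (i2 x (Finset.mem_sdiff.2 ⟨hx, h⟩)).trans n.le_succ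
      · intro x hx y hy hxy hxY hyY
        rw [Finset.mem_union, not_or] at hxY hyY
        by_cases hxU : x ∈ U <;> by_cases hyU : y ∈ U
        · simp [hxU, hyU]
        · exact absurd (hDmem x hxU y hy hyU hxy) hxY.1
        · exact absurd (hDmem y hyU x hx hxU hxy.symm) hyY.1
        · simpa [hxU, hyU] using i3 x (Finset.mem_sdiff.2 ⟨hx, hxU⟩) y
            (Finset.mem_sdiff.2 ⟨hy, hyU⟩) hxy hxY.2 hyY.2
      · intro x hx y hy hxy
        by_cases hxU : x ∈ U <;> by_cases hyU : y ∈ U <;> simp only [hxU, hyU, if_true, if_false] at hxy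
        · exact hdiam x hxU y hyU
        · have := i2 y (Finset.mem_sdiff.2 ⟨hy, hyU⟩); omega
        · have := i2 x (Finset.mem_sdiff.2 ⟨hx, hxU⟩); omega
        · exact i4 x (Finset.mem_sdiff.2 ⟨hx, hxU⟩) y (Finset.mem_sdiff.2 ⟨hy, hyU⟩) hxy
  obtain ⟨Y, c, h1, -, h3, h4⟩ := key _ Finset.univ le_rfl
  refine ⟨Y, Setoid.ker c, by rwa [hp1, mul_one] at h1, ?_, ?_⟩
  · exact fun x y hxy hx hy => h3 x (Finset.mem_univ _) y (Finset.mem_univ _) hxy hx hy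
  · exact fun x y _ _ hxy => h4 x (Finset.mem_univ _) y (Finset.mem_univ _) hxy

/-! ### Projected gradient descent -/

/-- Projected gradient descent with respect to a weighted inner product: the average of the
values of the iterates is at most the value at `v`, up to explicit errors. -/
theorem sum_projected_descent_le {ι : Type*} (A : Finset ι) {q : ι → ℝ} (hq : ∀ i, 0 ≤ q i)
    (F : (ι → ℝ) → ℝ) {w g : ℕ → ι → ℝ} {v : ι → ℝ} (hv : ∀ i, 0 ≤ v i) {η B : ℝ} (hη : 0 < η)
    (hw0 : ∀ i, w 0 i = 0) (hw : ∀ k i, w (k + 1) i = max 0 (w k i - η * g k i))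
    (hF : ∀ k, F (w k) - F v ≤ ∑ i ∈ A, q i * g k i * (w k i - v i))
    (hg : ∀ k, ∀ i ∈ A, |g k i| ≤ B) (T : ℕ) :
    2 * η * ∑ k ∈ Finset.range T, (F (w k) - F v) ≤
      ∑ i ∈ A, q i * v i ^ 2 + T * (η ^ 2 * B ^ 2 * ∑ i ∈ A, q i) := by
  -- The weighted squared distance to `v` is the potential that telescopes.
  have key : 2 * η * ∑ k ∈ Finset.range T, (F (w k) - F v) + ∑ i ∈ A, q i * (w T i - v i) ^ 2 ≤
      ∑ i ∈ A, q i * v i ^ 2 + T * (η ^ 2 * B ^ 2 * ∑ i ∈ A, q i) := by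
    induction T with
    | zero => simp [hw0]
    | succ T ih =>
      have hstep : ∑ i ∈ A, q i * (w (T + 1) i - v i) ^ 2 ≤ ∑ i ∈ A, q i * (w T i - v i) ^ 2 -
          2 * η * ∑ i ∈ A, q i * g T i * (w T i - v i) + η ^ 2 * B ^ 2 * ∑ i ∈ A, q i := by
        rw [Finset.mul_sum, Finset.mul_sum, ← Finset.sum_sub_distrib, ← Finset.sum_add_distrib]
        refine Finset.sum_le_sum fun i hi => ?_
        -- Projection to the nonnegative half-line does not increase the distance to `v i ≥ 0`.
        have h1 : (w (T + 1) i - v i) ^ 2 ≤ (w T i - η * g T i - v i) ^ 2 := by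
          rw [hw]
          rcases le_total 0 (w T i - η * g T i) with h | h
          · rw [max_eq_right h]
          · rw [max_eq_left h]; nlinarith [hv i]
        have h2 : g T i ^ 2 ≤ B ^ 2 := sq_le_sq' (abs_le.1 (hg T i hi)).1 (abs_le.1 (hg T i hi)).2
        have h3 : η ^ 2 * g T i ^ 2 ≤ η ^ 2 * B ^ 2 := by gcongr
        calc q i * (w (T + 1) i - v i) ^ 2 ≤ q i * (w T i - η * g T i - v i) ^ 2 :=
              mul_le_mul_of_nonneg_left h1 (hq i)
          _ = q i * (w T i - v i) ^ 2 - 2 * η * (q i * g T i * (w T i - v i)) +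
              q i * (η ^ 2 * g T i ^ 2) := by ring
          _ ≤ _ := by
            have := mul_le_mul_of_nonneg_left h3 (hq i)
            linarith
      rw [Finset.sum_range_succ]
      push_cast
      have := mul_le_mul_of_nonneg_left (hF T) hη.le
      linarith
  have : 0 ≤ ∑ i ∈ A, q i * (w T i - v i) ^ 2 :=
    Finset.sum_nonneg fun i _ => mul_nonneg (hq i) (sq_nonneg _)
  linarith

open Classical

/-! ### A convex relaxation by weighted covers -/

namespace SimpleGraph

variable {V : Type} (G : SimpleGraph V)

/-- The largest `p`-measure of an independent subset of `U`. -/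
noncomputable def indepWeight (p : V → ℝ) (U : Finset V) : ℝ :=
  (U.powerset.filter fun I : Finset V => G.IsIndepSet (I : Set V)).sup' ⟨∅, by simp⟩ fun I => ∑ x ∈ I, p x

variable {G}

theorem le_indepWeight (p : V → ℝ) {U I : Finset V} (hI : I ⊆ U) (h : G.IsIndepSet (I : Set V)) :
    ∑ x ∈ I, p x ≤ G.indepWeight p U :=
  Finset.le_sup' (fun I => ∑ x ∈ I, p x)
    (Finset.mem_filter.2 ⟨Finset.mem_powerset.2 hI, h⟩)

theorem exists_indepWeight_eq (G : SimpleGraph V) (p : V → ℝ) (U : Finset V) :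
    ∃ I ⊆ U, G.IsIndepSet (I : Set V) ∧ G.indepWeight p U = ∑ x ∈ I, p x := by
  have hne : (U.powerset.filter fun I : Finset V => G.IsIndepSet (I : Set V)).Nonempty :=
    ⟨∅, by simp⟩
  obtain ⟨I, hI, h⟩ := Finset.exists_mem_eq_sup' hne fun I => ∑ x ∈ I, p x
  rw [Finset.mem_filter, Finset.mem_powerset] at hI
  exact ⟨I, hI.1, hI.2, h⟩

theorem indepWeight_nonneg (p : V → ℝ) (U : Finset V) : 0 ≤ G.indepWeight p U := by
  simpa using G.le_indepWeight p (Finset.empty_subset U) (by simp)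

theorem indepWeight_le_sum {p : V → ℝ} (hp : ∀ v, 0 < p v) (U : Finset V) :
    G.indepWeight p U ≤ ∑ x ∈ U, p x := by
  obtain ⟨I, hI, -, h⟩ := G.exists_indepWeight_eq p U
  rw [h]
  exact Finset.sum_le_sum_of_subset_of_nonneg hI fun x _ _ => (hp x).le

variable (G) [Fintype V]

/-- The nonempty vertex sets of diameter at most `R`. -/
noncomputable def smallSets (R : ℕ) : Finset (Finset V) :=
  Finset.univ.filter fun U => U.Nonempty ∧ ∀ x ∈ U, ∀ y ∈ U, G.edist x y ≤ R

/-- The total `w`-weight of the small sets that contain `x`. -/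
noncomputable def coverage (R : ℕ) (w : Finset V → ℝ) (x : V) : ℝ :=
  ∑ U ∈ G.smallSets R with x ∈ U, w U

/-- The amount by which the coverage of `x` falls short of `1`. -/
noncomputable def slack (R : ℕ) (w : Finset V → ℝ) (x : V) : ℝ := max 0 (1 - G.coverage R w x)

/-- A convex upper bound, up to `1 / (2 * lam)`, of the independence number. -/
noncomputable def coverCost (p : V → ℝ) (R : ℕ) (lam : ℝ) (w : Finset V → ℝ) : ℝ :=
  ∑ U ∈ G.smallSets R, w U * G.indepWeight p U + lam / 2 * ∑ x, p x * G.slack R w x ^ 2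

/-- The gradient of `coverCost`, for the inner product weighted by the measures of the sets. -/
noncomputable def coverGrad (p : V → ℝ) (R : ℕ) (lam : ℝ) (w : Finset V → ℝ) (U : Finset V) : ℝ :=
  G.indepWeight p U / ∑ x ∈ U, p x - lam * ((∑ x ∈ U, p x * G.slack R w x) / ∑ x ∈ U, p x)

/-- The iterates of projected gradient descent for `coverCost`. -/
noncomputable def coverIter (p : V → ℝ) (R : ℕ) (lam η : ℝ) : ℕ → Finset V → ℝ
  | 0 => fun _ => 0
  | k + 1 => fun U => max 0 (coverIter p R lam η k U -
      η * G.coverGrad p R lam (coverIter p R lam η k) U)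

variable {G}

theorem mem_smallSets {R : ℕ} {U : Finset V} : U ∈ G.smallSets R ↔
    U.Nonempty ∧ ∀ x ∈ U, ∀ y ∈ U, G.edist x y ≤ R := by
  simp [smallSets]

theorem slack_nonneg (R : ℕ) (w : Finset V → ℝ) (x : V) : 0 ≤ G.slack R w x := le_max_left _ _

theorem slack_le_one {R : ℕ} {w : Finset V → ℝ} (hw : ∀ U, 0 ≤ w U) (x : V) :
    G.slack R w x ≤ 1 := by
  have : 0 ≤ G.coverage R w x := Finset.sum_nonneg fun U _ => hw U
  exact max_le zero_le_one (by linarith)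

theorem sum_pos_of_mem_smallSets {p : V → ℝ} (hp : ∀ v, 0 < p v) {R : ℕ} {U : Finset V}
    (hU : U ∈ G.smallSets R) : 0 < ∑ x ∈ U, p x :=
  Finset.sum_pos (fun x _ => hp x) (mem_smallSets.1 hU).1

theorem sum_mul_slack_nonneg {p : V → ℝ} (hp : ∀ v, 0 < p v) (R : ℕ) (w : Finset V → ℝ)
    (U : Finset V) : 0 ≤ ∑ x ∈ U, p x * G.slack R w x :=
  Finset.sum_nonneg fun x _ => mul_nonneg (hp x).le (slack_nonneg _ _ _)

theorem sum_mul_slack_le {p : V → ℝ} (hp : ∀ v, 0 < p v) (R : ℕ) {w : Finset V → ℝ}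
    (hw : ∀ U, 0 ≤ w U) (U : Finset V) : ∑ x ∈ U, p x * G.slack R w x ≤ ∑ x ∈ U, p x :=
  Finset.sum_le_sum fun x _ => mul_le_of_le_one_right (hp x).le (slack_le_one hw x)

theorem sum_smallSets_sum_mem (R : ℕ) (f : Finset V → ℝ) (g : V → ℝ) :
    ∑ U ∈ G.smallSets R, f U * ∑ x ∈ U, g x = ∑ x, g x * ∑ U ∈ G.smallSets R with x ∈ U, f U := by
  simp_rw [Finset.mul_sum, mul_comm (f _)]
  exact Finset.sum_comm' (by simp)

/-- Coverage plus slack is at least 1 at every vertex of an optimal I. The coverage part sums to Σ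
w_U p(I ∩ U) ≤ Σ w_U i(U); the slack part is handled by s ≤ (λ/2)s² + 1/(2λ). -/
theorem indepWeight_univ_le {p : V → ℝ} (hp : ∀ v, 0 < p v) (hp1 : ∑ v, p v = 1) (R : ℕ)
    {lam : ℝ} (hl : 0 < lam) {w : Finset V → ℝ} (hw : ∀ U, 0 ≤ w U) :
    G.indepWeight p Finset.univ ≤ G.coverCost p R lam w + 1 / (2 * lam) := by
  obtain ⟨I, -, hI, h⟩ := G.exists_indepWeight_eq p Finset.univ
  rw [h]
  have h1 : ∀ x, p x ≤ p x * G.coverage R w x + p x * G.slack R w x := fun x => by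
    rw [← mul_add]
    refine le_mul_of_one_le_right (hp x).le ?_
    have := le_max_right 0 (1 - G.coverage R w x)
    change 1 ≤ _ + max 0 (1 - G.coverage R w x)
    linarith
  have h2 : ∑ x ∈ I, p x * G.coverage R w x ≤ ∑ U ∈ G.smallSets R, w U * G.indepWeight p U := by
    have := G.sum_smallSets_sum_mem R w (fun x => if x ∈ I then p x else 0)
    simp_rw [ite_mul, zero_mul] at this
    rw [← Finset.sum_filter, Finset.filter_mem_eq_inter, Finset.univ_inter] at this
    refine (this.symm.le).trans (Finset.sum_le_sum fun U _ => ?_)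
    refine mul_le_mul_of_nonneg_left ?_ (hw U)
    rw [← Finset.sum_filter]
    refine le_indepWeight p (Finset.filter_subset _ _) (hI.mono ?_)
    intro x hx
    exact (Finset.mem_filter.1 (Finset.mem_coe.1 hx)).2
  have h3 : ∑ x ∈ I, p x * G.slack R w x ≤
      lam / 2 * ∑ x, p x * G.slack R w x ^ 2 + 1 / (2 * lam) := by
    calc ∑ x ∈ I, p x * G.slack R w x ≤ ∑ x, p x * G.slack R w x :=
          Finset.sum_le_sum_of_subset_of_nonneg (Finset.subset_univ _) fun x _ _ =>
            mul_nonneg (hp x).le (slack_nonneg _ _ _)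
      _ ≤ ∑ x, (lam / 2 * (p x * G.slack R w x ^ 2) + 1 / (2 * lam) * p x) := by
          refine Finset.sum_le_sum fun x _ => ?_
          have : G.slack R w x ≤ lam / 2 * G.slack R w x ^ 2 + 1 / (2 * lam) := by
            have : lam / 2 * G.slack R w x ^ 2 + 1 / (2 * lam) - G.slack R w x =
              (lam * G.slack R w x - 1) ^ 2 / (2 * lam) := by field_simp; ring
            have : 0 ≤ (lam * G.slack R w x - 1) ^ 2 / (2 * lam) := by positivity
            linarith
          have := mul_le_mul_of_nonneg_left this (hp x).le
          linarith
      _ = _ := by rw [Finset.sum_add_distrib, ← Finset.mul_sum, ← Finset.mul_sum, hp1, mul_one]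
  calc ∑ x ∈ I, p x ≤ ∑ x ∈ I, (p x * G.coverage R w x + p x * G.slack R w x) :=
        Finset.sum_le_sum fun x _ => h1 x
    _ ≤ _ := by rw [Finset.sum_add_distrib, coverCost]; linarith

/-- First-order convexity: the cost is linear plus a sum of squares of positive parts of affine
functions. -/
theorem coverCost_sub_le {p : V → ℝ} (hp : ∀ v, 0 < p v) (R : ℕ) {lam : ℝ} (hl : 0 < lam)
    (w v : Finset V → ℝ) : G.coverCost p R lam w - G.coverCost p R lam v ≤
      ∑ U ∈ G.smallSets R, (∑ x ∈ U, p x) * G.coverGrad p R lam w U * (w U - v U) := by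
  have h1 : ∀ U ∈ G.smallSets R, (∑ x ∈ U, p x) * G.coverGrad p R lam w U * (w U - v U) =
      (w U * G.indepWeight p U - v U * G.indepWeight p U) -
        lam * ((w U - v U) * ∑ x ∈ U, p x * G.slack R w x) := fun U hU => by
    have := (sum_pos_of_mem_smallSets hp hU).ne'
    rw [coverGrad]
    field_simp
  rw [Finset.sum_congr rfl h1, Finset.sum_sub_distrib, Finset.sum_sub_distrib, ← Finset.mul_sum,
    G.sum_smallSets_sum_mem R (fun U => w U - v U)]
  have h2 : ∀ x, p x * G.slack R w x ^ 2 - p x * G.slack R v x ^ 2 ≤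
      -2 * (p x * G.slack R w x * ∑ U ∈ G.smallSets R with x ∈ U, (w U - v U)) := fun x => by
    rw [Finset.sum_sub_distrib]
    change _ ≤ -2 * (p x * G.slack R w x * (G.coverage R w x - G.coverage R v x))
    have : G.slack R w x ^ 2 - G.slack R v x ^ 2 ≤
        -2 * (G.slack R w x * (G.coverage R w x - G.coverage R v x)) := by
      have e1 : 1 - G.coverage R v x ≤ G.slack R v x := le_max_right _ _
      rcases le_total 0 (1 - G.coverage R w x) with h | h
      · have e2 : G.slack R w x = 1 - G.coverage R w x := max_eq_right h
        rw [← e2] at h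
        have := mul_le_mul_of_nonneg_left e1 h
        nlinarith [sq_nonneg (G.slack R w x - G.slack R v x)]
      · have e2 : G.slack R w x = 0 := max_eq_left h
        rw [e2]; nlinarith [sq_nonneg (G.slack R v x)]
    have := mul_le_mul_of_nonneg_left this (hp x).le
    linarith
  have h3 := Finset.sum_le_sum fun x (_ : x ∈ Finset.univ) => h2 x
  rw [Finset.sum_sub_distrib, ← Finset.mul_sum] at h3
  have h4 := mul_le_mul_of_nonneg_left h3 (by positivity : 0 ≤ lam / 2)
  simp only [coverCost]
  linarith

theorem coverIter_nonneg (p : V → ℝ) (R : ℕ) (lam η : ℝ) (k : ℕ) (U : Finset V) :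
    0 ≤ G.coverIter p R lam η k U := by
  cases k with
  | zero => exact le_rfl
  | succ k => exact le_max_left _ _

/-- Both quotients by p(U) lie in [0, 1]. Thus step size and number of steps can be chosen
independently of the graph. -/
theorem abs_coverGrad_le {p : V → ℝ} (hp : ∀ v, 0 < p v) {R : ℕ} {lam : ℝ} (hl : 0 < lam)
    {w : Finset V → ℝ} (hw : ∀ U, 0 ≤ w U) (U : Finset V) :
    -lam ≤ G.coverGrad p R lam w U ∧ G.coverGrad p R lam w U ≤ 1 := by
  have hU : 0 ≤ ∑ x ∈ U, p x := Finset.sum_nonneg fun x _ => (hp x).le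
  have h1 : G.indepWeight p U / ∑ x ∈ U, p x ≤ 1 :=
    div_le_one_of_le₀ (indepWeight_le_sum hp U) hU
  have h2 : 0 ≤ G.indepWeight p U / ∑ x ∈ U, p x := div_nonneg (indepWeight_nonneg p U) hU
  have h3 : (∑ x ∈ U, p x * G.slack R w x) / ∑ x ∈ U, p x ≤ 1 :=
    div_le_one_of_le₀ (sum_mul_slack_le hp R hw U) hU
  have h4 : 0 ≤ (∑ x ∈ U, p x * G.slack R w x) / ∑ x ∈ U, p x :=
    div_nonneg (sum_mul_slack_nonneg hp R w U) hU
  rw [coverGrad]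
  constructor <;> nlinarith

theorem coverIter_le {p : V → ℝ} (hp : ∀ v, 0 < p v) {R : ℕ} {lam η : ℝ} (hl : 0 < lam)
    (hη : 0 < η) (k : ℕ) (U : Finset V) : G.coverIter p R lam η k U ≤ k * (η * lam) := by
  induction k with
  | zero => simp [coverIter]
  | succ k ih =>
    have h := (G.abs_coverGrad_le hp (R := R) hl (coverIter_nonneg (G := G) p R lam η k) U).1
    have h := mul_le_mul_of_nonneg_left h hη.le
    push_cast
    refine max_le (by positivity) ?_
    linarith

/-- A partition into small pieces, up to a set of small measure, yields a cheap cover. -/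
theorem exists_coverCost_le {p : V → ℝ} (hp : ∀ v, 0 < p v) (hp1 : ∑ v, p v = 1) {R : ℕ} {lam : ℝ}
    (hl : 0 < lam) {Y : Finset V} {s : Setoid V}
    (hs : ∀ x y, G.Adj x y → x ∉ Y → y ∉ Y → s x y)
    (hR : ∀ x y, x ∉ Y → y ∉ Y → s x y → G.edist x y ≤ R) :
    ∃ v : Finset V → ℝ, (∀ U, 0 ≤ v U) ∧
      G.coverCost p R lam v ≤ G.indepWeight p Finset.univ + lam / 2 * ∑ x ∈ Y, p x ∧
      ∑ U ∈ G.smallSets R, (∑ x ∈ U, p x) * v U ^ 2 ≤ 1 := by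
  let cl : V → Finset V := fun x => Finset.univ.filter fun y => y ∉ Y ∧ s x y
  have hcl : ∀ x y, y ∈ cl x ↔ y ∉ Y ∧ s x y := fun x y => by simp [cl]
  let P : Finset (Finset V) := Yᶜ.image cl
  have hP : ∀ U ∈ P, U ∈ G.smallSets R := fun U hU => by
    obtain ⟨x, hx, rfl⟩ := Finset.mem_image.1 hU
    rw [Finset.mem_compl] at hx
    refine mem_smallSets.2 ⟨⟨x, (hcl _ _).2 ⟨hx, s.refl x⟩⟩, fun y hy z hz => ?_⟩
    rw [hcl] at hy hz
    exact hR y z hy.1 hz.1 (s.trans (s.symm hy.2) hz.2)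
  have hUniq : ∀ U ∈ P, ∀ y ∈ U, y ∉ Y ∧ U = cl y := fun U hU y hy => by
    obtain ⟨x, hx, rfl⟩ := Finset.mem_image.1 hU
    rw [hcl] at hy
    refine ⟨hy.1, ?_⟩
    ext z
    rw [hcl, hcl]
    exact and_congr_right fun _ => ⟨fun h => s.trans (s.symm hy.2) h, fun h => s.trans hy.2 h⟩
  have hdisj : Set.PairwiseDisjoint (P : Set (Finset V)) id := fun U hU U' hU' hne => by
    refine Finset.disjoint_left.2 fun y hy hy' => hne ?_
    rw [(hUniq U hU y hy).2, ← (hUniq U' hU' y hy').2]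
  have hPsum : ∀ f : Finset V → ℝ, ∑ U ∈ G.smallSets R, (if U ∈ P then f U else 0) =
      ∑ U ∈ P, f U := fun f => by
    rw [← Finset.sum_filter]
    refine Finset.sum_congr ?_ fun _ _ => rfl
    ext U
    simp only [Finset.mem_filter]
    exact ⟨fun h => h.2, fun h => ⟨hP U h, h⟩⟩
  refine ⟨fun U => if U ∈ P then 1 else 0, fun U => by dsimp only; split_ifs <;> norm_num, ?_, ?_⟩
  · refine add_le_add ?_ (mul_le_mul_of_nonneg_left ?_ (by positivity))
    · simp_rw [ite_mul, one_mul, zero_mul]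
      rw [hPsum]
      -- Optimal sets of the pieces have an independent union, because adjacent vertices outside Y
      -- share a piece.
      choose I hIU hI hIe using G.exists_indepWeight_eq p
      have hID : Set.PairwiseDisjoint (P : Set (Finset V)) I := fun U hU U' hU' hne =>
        (hdisj hU hU' hne).mono (hIU U) (hIU U')
      rw [Finset.sum_congr rfl fun U _ => hIe U, ← Finset.sum_biUnion hID]
      refine le_indepWeight p (Finset.subset_univ _) ?_
      intro x hx y hy hne hadj
      rw [Finset.mem_coe, Finset.mem_biUnion] at hx hy
      obtain ⟨U, hU, hx⟩ := hx
      obtain ⟨U', hU', hy⟩ := hy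
      obtain ⟨hxY, hx'⟩ := hUniq U hU x (hIU U hx)
      obtain ⟨hyY, hy'⟩ := hUniq U' hU' y (hIU U' hy)
      have : y ∈ U := by
        rw [hx', hcl]
        exact ⟨hyY, hs x y hadj hxY hyY⟩
      obtain rfl : U = U' := by rw [(hUniq U hU y this).2, ← hy']
      exact hI U hx hy hne hadj
    · rw [← Finset.sum_filter_add_sum_filter_not Finset.univ (fun x => x ∈ Y)]
      have e1 : (Finset.univ.filter fun x => x ∈ Y) = Y := by ext; simp
      rw [e1]
      have e2 : ∑ x with x ∉ Y, p x * G.slack R (fun U => if U ∈ P then 1 else 0) x ^ 2 = 0 := by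
        refine Finset.sum_eq_zero fun x hx => ?_
        have hx : x ∉ Y := (Finset.mem_filter.1 hx).2
        have hxP : cl x ∈ P := Finset.mem_image_of_mem _ (Finset.mem_compl.2 hx)
        have : 1 ≤ G.coverage R (fun U => if U ∈ P then 1 else 0) x := by
          have := Finset.single_le_sum (f := fun U => if U ∈ P then (1 : ℝ) else 0)
            (s := (G.smallSets R).filter fun U => x ∈ U)
            (fun U _ => by split_ifs <;> norm_num)
            (Finset.mem_filter.2 ⟨hP _ hxP, (hcl x x).2 ⟨hx, s.refl x⟩⟩)
          simpa [hxP, coverage] using this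
        have e : G.slack R (fun U => if U ∈ P then 1 else 0) x = 0 := max_eq_left (by linarith)
        rw [e]; ring
      rw [e2, add_zero]
      refine Finset.sum_le_sum fun x _ => mul_le_of_le_one_right (hp x).le ?_
      exact pow_le_one₀ (slack_nonneg _ _ _) (slack_le_one (fun U => by split_ifs <;> norm_num) x)
  · have : ∀ U, (∑ x ∈ U, p x) * (if U ∈ P then (1 : ℝ) else 0) ^ 2 =
        if U ∈ P then ∑ x ∈ U, p x else 0 := fun U => by split_ifs <;> simp
    simp_rw [this]
    rw [hPsum, ← hp1]
    have h := Finset.sum_biUnion (f := p) hdisj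
    simp only [id] at h
    rw [← h]
    exact Finset.sum_le_sum_of_subset_of_nonneg (Finset.subset_univ _) fun x _ _ => (hp x).le

/-- The average cost of the iterates is close to the independence number. -/
theorem abs_average_coverCost_sub_le {p : V → ℝ} (hp : ∀ v, 0 < p v) (hp1 : ∑ v, p v = 1) {R : ℕ}
    {lam η : ℝ} (hl : 0 < lam) (hη : 0 < η) {M : ℕ}
    (hM : ∀ x, ((G.smallSets R).filter fun U => x ∈ U).card ≤ M) {Y : Finset V} {s : Setoid V}
    (hs : ∀ x y, G.Adj x y → x ∉ Y → y ∉ Y → s x y)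
    (hR : ∀ x y, x ∉ Y → y ∉ Y → s x y → G.edist x y ≤ R) {T : ℕ} (hT : 0 < T) :
    |G.indepWeight p Finset.univ -
      (∑ k ∈ Finset.range T, G.coverCost p R lam (G.coverIter p R lam η k)) / T| ≤
      1 / (2 * lam) + lam / 2 * ∑ x ∈ Y, p x + 1 / (2 * η * T) + η * (1 + lam) ^ 2 * M / 2 := by
  have hT' : (0 : ℝ) < T := by exact_mod_cast hT
  have hY : 0 ≤ ∑ x ∈ Y, p x := Finset.sum_nonneg fun x _ => (hp x).le
  have hpos : ∀ k U, 0 ≤ G.coverIter p R lam η k U := coverIter_nonneg p R lam η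
  obtain ⟨v, hv, hv1, hv2⟩ := exists_coverCost_le hp hp1 (R := R) hl hs hR
  have hdesc := sum_projected_descent_le (G.smallSets R) (q := fun U => ∑ x ∈ U, p x)
    (fun U => Finset.sum_nonneg fun x _ => (hp x).le) (G.coverCost p R lam)
    (w := G.coverIter p R lam η) (g := fun k => G.coverGrad p R lam (G.coverIter p R lam η k))
    hv (B := 1 + lam) hη (fun _ => rfl) (fun _ _ => rfl) (fun k => coverCost_sub_le hp R hl _ _)
    (fun k U _ => by
      obtain ⟨h1, h2⟩ := abs_coverGrad_le (G := G) (R := R) hp hl (hpos k) U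
      exact abs_le.2 ⟨by linarith, by linarith⟩) T
  -- Double counting: each vertex lies in at most M small sets.
  have hq : ∑ U ∈ G.smallSets R, ∑ x ∈ U, p x ≤ M := by
    have := G.sum_smallSets_sum_mem R (fun _ => 1) p
    simp only [one_mul] at this
    rw [this]
    calc _ ≤ ∑ x, p x * M := Finset.sum_le_sum fun x _ => by
          refine mul_le_mul_of_nonneg_left ?_ (hp x).le
          simpa using hM x
      _ = M := by rw [← Finset.sum_mul, hp1, one_mul]
  rw [Finset.sum_sub_distrib, Finset.sum_const, Finset.card_range, nsmul_eq_mul] at hdesc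
  set S := ∑ k ∈ Finset.range T, G.coverCost p R lam (G.coverIter p R lam η k)
  set i := G.indepWeight p Finset.univ
  have hlow : T * i ≤ S + T * (1 / (2 * lam)) := by
    have : ∑ k ∈ Finset.range T, i ≤ ∑ k ∈ Finset.range T,
        (G.coverCost p R lam (G.coverIter p R lam η k) + 1 / (2 * lam)) :=
      Finset.sum_le_sum fun k _ => indepWeight_univ_le hp hp1 R hl (hpos k)
    simpa [Finset.sum_add_distrib] using this
  -- Descent compared with the cover `v` given by the partition, whose weighted norm is at most 1.
  have hup : S ≤ T * (i + lam / 2 * ∑ x ∈ Y, p x) + 1 / (2 * η) +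
      T * (η * (1 + lam) ^ 2 * M / 2) := by
    have h1 : 2 * η * (S - T * G.coverCost p R lam v) ≤ 1 + T * (η ^ 2 * (1 + lam) ^ 2 * M) := by
      refine hdesc.trans (add_le_add hv2 ?_)
      gcongr
    have h2 : S - T * G.coverCost p R lam v ≤ (1 + T * (η ^ 2 * (1 + lam) ^ 2 * M)) / (2 * η) := by
      rw [le_div_iff₀ (by positivity)]; linarith
    have h3 : (1 + T * (η ^ 2 * (1 + lam) ^ 2 * M)) / (2 * η) =
        1 / (2 * η) + T * (η * (1 + lam) ^ 2 * M / 2) := by field_simp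
    have h4 := mul_le_mul_of_nonneg_left hv1 hT'.le
    linarith
  have e1 : 0 ≤ 1 / (2 * lam) := by positivity
  have e2 : 0 ≤ lam / 2 * ∑ x ∈ Y, p x := by positivity
  have e3 : 0 ≤ 1 / (2 * η * T) := by positivity
  have e4 : 0 ≤ η * (1 + lam) ^ 2 * M / 2 := by positivity
  have hdiv : S / T * T = S := div_mul_cancel₀ _ hT'.ne'
  have e5 : 1 / (2 * η * T) * T = 1 / (2 * η) := by field_simp
  rw [abs_le]
  constructor
  · refine le_of_mul_le_mul_right ?_ hT'
    nlinarith
  · refine le_of_mul_le_mul_right ?_ hT'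
    nlinarith

end SimpleGraph

/-! ### Nearly isomorphic weighted balls -/

namespace SimpleGraph

/-- The closed ball in the graph metric. -/
def cball {V : Type*} (G : SimpleGraph V) (x : V) (r : ℕ) : Set V := {y | G.edist x y ≤ r}

section cball

variable {V : Type*} {G : SimpleGraph V} {x y z : V} {r s : ℕ}

theorem mem_cball_self (x : V) (r : ℕ) : x ∈ G.cball x r := by simp [cball]

theorem mem_cball : y ∈ G.cball x r ↔ G.edist x y ≤ r := Iff.rfl

theorem cball_mono (x : V) (h : r ≤ s) : G.cball x r ⊆ G.cball x s := fun _ hy =>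
  mem_cball.2 ((mem_cball.1 hy).trans (by exact_mod_cast h))

theorem mem_cball_trans (hy : y ∈ G.cball x r) (hz : z ∈ G.cball y s) : z ∈ G.cball x (r + s) := by
  have := G.edist_triangle.trans (add_le_add hy hz)
  rw [mem_cball]
  exact_mod_cast this

theorem Adj.mem_cball (h : G.Adj x y) : y ∈ G.cball x 1 :=
  (edist_eq_one_iff_adj.2 h).le

theorem mem_cball_zero : y ∈ G.cball x 0 ↔ y = x := by
  rw [mem_cball, Nat.cast_zero, nonpos_iff_eq_zero, edist_eq_zero_iff, eq_comm]

theorem mem_cball_succ : z ∈ G.cball x (r + 1) ↔ z ∈ G.cball x r ∨ ∃ y ∈ G.cball x r, G.Adj y z := by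
  constructor
  · intro h
    by_cases hr : z ∈ G.cball x r
    · exact Or.inl hr
    have h1 : G.edist x z ≤ ((r + 1 : ℕ) : ℕ∞) := h
    have hreach : G.edist x z ≠ ⊤ := fun e => by
      rw [e] at h1; exact absurd h1 (not_le.2 (ENat.natCast_lt_top _))
    obtain ⟨w, hw⟩ := exists_walk_of_edist_ne_top hreach
    rw [← hw] at h1
    have h2 : w.length ≤ r + 1 := by exact_mod_cast h1
    induction w using Walk.concatRec with
    | Hnil => exact absurd (mem_cball_self _ _) hr
    | @Hconcat x y z p hyz _ =>
      rw [Walk.length_concat] at h2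
      refine Or.inr ⟨y, (G.edist_le p).trans ?_, hyz⟩
      exact_mod_cast (by omega : p.length ≤ r)
  · rintro (h | ⟨y, hy, hyz⟩)
    · exact cball_mono _ (Nat.le_succ r) h
    · exact mem_cball_trans hy hyz.mem_cball

end cball

variable {V V' : Type}

/-- `f` maps the `r`-ball at `x` isomorphically to the `r`-ball at `f x`, and changes quotients of
weights at most by the factor `1 + δ`. -/
structure IsCloseAt (G : SimpleGraph V) (p : V → ℝ) (G' : SimpleGraph V') (p' : V' → ℝ)
    (f : V → V') (r : ℕ) (δ : ℝ) (x : V) : Prop where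
  bijOn : Set.BijOn f (G.cball x r) (G'.cball (f x) r)
  adj_iff : ∀ y ∈ G.cball x r, ∀ z ∈ G.cball x r, G'.Adj (f y) (f z) ↔ G.Adj y z
  ratio_le : ∀ y ∈ G.cball x r, ∀ z ∈ G.cball x r, p' (f y) * p z ≤ (1 + δ) * (p y * p' (f z))

namespace IsCloseAt

variable {G : SimpleGraph V} {p : V → ℝ} {G' : SimpleGraph V'} {p' : V' → ℝ} {f : V → V'}
  {r s n R : ℕ} {δ δ' : ℝ} {x y z : V}

/-- Balls grow edge by edge, and as long as s + n ≤ r all edges involved lie inside the r-balls,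
where f is an isomorphism. -/
theorem image_cball_of_mem (h : IsCloseAt G p G' p' f r δ x) (hy : y ∈ G.cball x s)
    (hy' : f y ∈ G'.cball (f x) s) (hn : s + n ≤ r) : f '' G.cball y n = G'.cball (f y) n := by
  induction n with
  | zero =>
    ext z
    simp only [Set.mem_image, mem_cball_zero, exists_eq_left]
    exact eq_comm
  | succ n ih =>
    have ih := ih (by omega)
    have hsub : ∀ {k}, k ≤ n + 1 → ∀ {z}, z ∈ G.cball y k → z ∈ G.cball x r := fun hk _ hz =>
      cball_mono x (by omega) (mem_cball_trans hy hz)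
    ext z'
    constructor
    · rintro ⟨z, hz, rfl⟩
      rcases mem_cball_succ.1 hz with hz | ⟨u, hu, huz⟩
      · exact cball_mono _ n.le_succ (ih ▸ Set.mem_image_of_mem f hz)
      · exact mem_cball_succ.2 (Or.inr ⟨f u, ih ▸ Set.mem_image_of_mem f hu,
          (h.adj_iff u (hsub n.le_succ hu) z (hsub le_rfl hz)).2 huz⟩)
    · intro hz'
      rcases mem_cball_succ.1 hz' with hz | ⟨u', hu', huz⟩
      · rw [← ih] at hz
        exact Set.image_mono (cball_mono _ n.le_succ) hz
      · rw [← ih] at hu'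
        obtain ⟨u, hu, rfl⟩ := hu'
        obtain ⟨z, hz, rfl⟩ := h.bijOn.surjOn (cball_mono _ hn (mem_cball_trans hy' hz'))
        exact ⟨z, mem_cball_succ.2 (Or.inr ⟨u, hu,
          (h.adj_iff u (hsub n.le_succ hu) z hz).1 huz⟩), rfl⟩

theorem image_cball (h : IsCloseAt G p G' p' f r δ x) (hy : y ∈ G.cball x s) (hn : s + n ≤ r) :
    f '' G.cball y n = G'.cball (f y) n := by
  refine h.image_cball_of_mem hy ?_ hn
  -- The case of the centre x shows that f y lies in the s-ball at f x.
  rw [← h.image_cball_of_mem (s := 0) (n := s) (mem_cball_self x 0) (mem_cball_self _ _) (by omega)]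
  exact Set.mem_image_of_mem f hy

theorem recenter (h : IsCloseAt G p G' p' f r δ x) (hy : y ∈ G.cball x s) (hn : s + n ≤ r) :
    IsCloseAt G p G' p' f n δ y := by
  have hsub : G.cball y n ⊆ G.cball x r := fun z hz => cball_mono x hn (mem_cball_trans hy hz)
  refine ⟨⟨?_, h.bijOn.injOn.mono hsub, ?_⟩, fun u hu z hz => h.adj_iff u (hsub hu) z (hsub hz),
    fun u hu z hz => h.ratio_le u (hsub hu) z (hsub hz)⟩
  · intro z hz
    rw [← h.image_cball hy hn]
    exact Set.mem_image_of_mem f hz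
  · rw [Set.SurjOn, h.image_cball hy hn]

theorem mono (h : IsCloseAt G p G' p' f r δ x) (hp : ∀ v, 0 < p v) (hp' : ∀ v, 0 < p' v)
    (hs : s ≤ r) (hδ : δ ≤ δ') : IsCloseAt G p G' p' f s δ' x := by
  have h := h.recenter (mem_cball_self x 0) (n := s) (by omega)
  refine ⟨h.bijOn, h.adj_iff, fun y hy z hz => (h.ratio_le y hy z hz).trans ?_⟩
  have := mul_pos (hp y) (hp' (f z))
  gcongr

theorem mem_cball_iff (h : IsCloseAt G p G' p' f r δ x) (hy : y ∈ G.cball x s)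
    (hz : z ∈ G.cball x r) (hn : s + n ≤ r) : f z ∈ G'.cball (f y) n ↔ z ∈ G.cball y n := by
  rw [← h.image_cball hy hn]
  constructor
  · rintro ⟨u, hu, hfu⟩
    rwa [← h.bijOn.injOn (cball_mono x hn (mem_cball_trans hy hu)) hz hfu]
  · exact Set.mem_image_of_mem f

variable [Fintype V] {U : Finset V}

theorem subset_cball (hU : U ∈ G.smallSets R) (hx : x ∈ U) : ∀ y ∈ U, y ∈ G.cball x R :=
  fun y hy => (mem_smallSets.1 hU).2 x hx y hy

theorem injOn_of_mem (h : IsCloseAt G p G' p' f r δ x) (hR : R ≤ r) (hU : U ∈ G.smallSets R)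
    (hx : x ∈ U) : Set.InjOn f U :=
  h.bijOn.injOn.mono fun y hy => cball_mono x hR (subset_cball hU hx y hy)

theorem mul_sum_le (h : IsCloseAt G p G' p' f r δ x) (hR : R ≤ r) (hU : U ∈ G.smallSets R)
    (hx : x ∈ U) : ∀ y ∈ U, p' (f y) * ∑ z ∈ U, p z ≤ (1 + δ) * (p y * ∑ z ∈ U.image f, p' z) ∧
      p y * ∑ z ∈ U.image f, p' z ≤ (1 + δ) * (p' (f y) * ∑ z ∈ U, p z) := by
  intro y hy
  have hsub : ∀ y ∈ U, y ∈ G.cball x r := fun y hy => cball_mono x hR (subset_cball hU hx y hy)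
  rw [Finset.sum_image (h.injOn_of_mem hR hU hx)]
  simp only [Finset.mul_sum]
  constructor
  · exact Finset.sum_le_sum fun z hz => h.ratio_le y (hsub y hy) z (hsub z hz)
  · refine Finset.sum_le_sum fun z hz => ?_
    have := h.ratio_le z (hsub z hz) y (hsub y hy)
    linarith

/-- Independent sets correspond under f and relative measures change at most by the factor 1 + δ;
since the quotients are at most 1, the additive error is at most δ. -/
theorem abs_indepWeight_sub_le (h : IsCloseAt G p G' p' f r δ x) (hp : ∀ v, 0 < p v)
    (hp' : ∀ v, 0 < p' v) (hR : R ≤ r) (hδ : 0 ≤ δ) (hU : U ∈ G.smallSets R) (hx : x ∈ U) :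
    |G.indepWeight p U / ∑ y ∈ U, p y -
      G'.indepWeight p' (U.image f) / ∑ y ∈ U.image f, p' y| ≤ δ := by
  have hsub : ∀ y ∈ U, y ∈ G.cball x r := fun y hy => cball_mono x hR (subset_cball hU hx y hy)
  have hinj := h.injOn_of_mem hR hU hx
  have hq : 0 < ∑ y ∈ U, p y := sum_pos_of_mem_smallSets hp hU
  have hq' : 0 < ∑ y ∈ U.image f, p' y :=
    Finset.sum_pos (fun y _ => hp' y) ⟨f x, Finset.mem_image_of_mem f hx⟩
  have hm := h.mul_sum_le hR hU hx
  set q := ∑ y ∈ U, p y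
  set q' := ∑ y ∈ U.image f, p' y
  have h1 : G'.indepWeight p' (U.image f) * q ≤ (1 + δ) * (G.indepWeight p U * q') := by
    obtain ⟨I', hI', hind, he⟩ := G'.exists_indepWeight_eq p' (U.image f)
    have hII : (U.filter fun y => f y ∈ I').image f = I' := by
      ext y'
      simp only [Finset.mem_image, Finset.mem_filter]
      constructor
      · rintro ⟨y, hy, rfl⟩; exact hy.2
      · intro hy'
        obtain ⟨y, hy, rfl⟩ := Finset.mem_image.1 (hI' hy')
        exact ⟨y, ⟨hy, hy'⟩, rfl⟩
    have hle := G.le_indepWeight p (U := U) (I := U.filter fun y => f y ∈ I')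
      (Finset.filter_subset _ _) (by
        intro y hy z hz hne hadj
        have hy := Finset.mem_filter.1 (Finset.mem_coe.1 hy)
        have hz := Finset.mem_filter.1 (Finset.mem_coe.1 hz)
        exact hind hy.2 hz.2 (fun e => hne (hinj hy.1 hz.1 e))
          ((h.adj_iff y (hsub y hy.1) z (hsub z hz.1)).2 hadj))
    calc _ = ∑ y ∈ U with f y ∈ I', p' (f y) * q := by
          rw [he, ← hII, Finset.sum_image (hinj.mono fun y hy =>
            (Finset.mem_filter.1 (Finset.mem_coe.1 hy)).1), Finset.sum_mul, hII]
      _ ≤ ∑ y ∈ U with f y ∈ I', (1 + δ) * (p y * q') :=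
          Finset.sum_le_sum fun y hy => (hm y (Finset.mem_filter.1 hy).1).1
      _ = (1 + δ) * ((∑ y ∈ U with f y ∈ I', p y) * q') := by
          rw [← Finset.mul_sum, Finset.sum_mul]
      _ ≤ _ := by gcongr
  have h2 : G.indepWeight p U * q' ≤ (1 + δ) * (G'.indepWeight p' (U.image f) * q) := by
    obtain ⟨I, hI, hind, he⟩ := G.exists_indepWeight_eq p U
    have hle := G'.le_indepWeight p' (U := U.image f) (I := I.image f)
      (Finset.image_subset_image hI) (by
        intro y' hy' z' hz' hne hadj
        obtain ⟨y, hy, rfl⟩ := Finset.mem_image.1 (Finset.mem_coe.1 hy')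
        obtain ⟨z, hz, rfl⟩ := Finset.mem_image.1 (Finset.mem_coe.1 hz')
        exact hind hy hz (fun e => hne (congrArg f e))
          ((h.adj_iff y (hsub y (hI hy)) z (hsub z (hI hz))).1 hadj))
    calc _ = ∑ y ∈ I, p y * q' := by rw [he, Finset.sum_mul]
      _ ≤ ∑ y ∈ I, (1 + δ) * (p' (f y) * q) :=
          Finset.sum_le_sum fun y hy => (hm y (hI hy)).2
      _ = (1 + δ) * ((∑ y ∈ I.image f, p' y) * q) := by
          rw [← Finset.mul_sum, Finset.sum_image (hinj.mono hI), Finset.sum_mul]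
      _ ≤ _ := by gcongr
  have e1 : G.indepWeight p U / q ≤ 1 := div_le_one_of_le₀ (indepWeight_le_sum hp U) hq.le
  have e2 : G'.indepWeight p' (U.image f) / q' ≤ 1 :=
    div_le_one_of_le₀ (indepWeight_le_sum hp' _) hq'.le
  have e3 : G'.indepWeight p' (U.image f) / q' ≤ (1 + δ) * (G.indepWeight p U / q) := by
    rw [mul_div_assoc', div_le_div_iff₀ hq' hq]; linarith
  have e4 : G.indepWeight p U / q ≤ (1 + δ) * (G'.indepWeight p' (U.image f) / q') := by
    rw [mul_div_assoc', div_le_div_iff₀ hq hq']; linarith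
  rw [abs_le]
  constructor <;> nlinarith

theorem abs_average_sub_le (h : IsCloseAt G p G' p' f r δ x) (hp : ∀ v, 0 < p v)
    (hp' : ∀ v, 0 < p' v) (hR : R ≤ r) (hδ : 0 ≤ δ) (hU : U ∈ G.smallSets R) (hx : x ∈ U)
    {m : V → ℝ} {m' : V' → ℝ} {e : ℝ} (hm0 : ∀ y, 0 ≤ m y) (hm1 : ∀ y, m y ≤ 1)
    (hm0' : ∀ y, 0 ≤ m' y) (hm1' : ∀ y, m' y ≤ 1) (he : ∀ y ∈ U, |m y - m' (f y)| ≤ e) :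
    |(∑ y ∈ U, p y * m y) / ∑ y ∈ U, p y -
      (∑ y ∈ U.image f, p' y * m' y) / ∑ y ∈ U.image f, p' y| ≤ e + δ := by
  have hinj := h.injOn_of_mem hR hU hx
  have hq : 0 < ∑ y ∈ U, p y := sum_pos_of_mem_smallSets hp hU
  have hq' : 0 < ∑ y ∈ U.image f, p' y :=
    Finset.sum_pos (fun y _ => hp' y) ⟨f x, Finset.mem_image_of_mem f hx⟩
  have hm := h.mul_sum_le hR hU hx
  have s1 : ∑ y ∈ U, p y / ∑ y ∈ U, p y = 1 := by rw [← Finset.sum_div, div_self hq.ne']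
  have s2 : ∑ y ∈ U, p' (f y) / ∑ y ∈ U.image f, p' y = 1 := by
    rw [← Finset.sum_div, ← Finset.sum_image hinj, div_self hq'.ne']
  set q := ∑ y ∈ U, p y
  set q' := ∑ y ∈ U.image f, p' y
  have a1 : ∀ y ∈ U, p' (f y) / q' ≤ (1 + δ) * (p y / q) := fun y hy => by
    rw [mul_div_assoc', div_le_div_iff₀ hq' hq]; linarith [(hm y hy).1]
  have a2 : ∀ y ∈ U, p y / q ≤ (1 + δ) * (p' (f y) / q') := fun y hy => by
    rw [mul_div_assoc', div_le_div_iff₀ hq hq']; linarith [(hm y hy).2]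
  have p1 : ∀ y, 0 < p y / q := fun y => div_pos (hp y) hq
  have p2 : ∀ y, 0 < p' (f y) / q' := fun y => div_pos (hp' _) hq'
  have E1 : (∑ y ∈ U, p y * m y) / q = ∑ y ∈ U, p y / q * m y := by
    rw [Finset.sum_div]; exact Finset.sum_congr rfl fun y _ => by ring
  have E2 : (∑ y ∈ U.image f, p' y * m' y) / q' = ∑ y ∈ U, p' (f y) / q' * m' (f y) := by
    rw [Finset.sum_image hinj, Finset.sum_div]; exact Finset.sum_congr rfl fun y _ => by ring
  rw [E1, E2, abs_le]
  constructor
  · have : ∑ y ∈ U, p' (f y) / q' * m' (f y) ≤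
        ∑ y ∈ U, (p y / q * m y + (e + δ) * (p y / q)) := Finset.sum_le_sum fun y hy => by
      have h1 := mul_le_mul_of_nonneg_right (a1 y hy) (hm0' (f y))
      have h2 := mul_le_mul_of_nonneg_left (abs_le.1 (he y hy)).1 (p1 y).le
      have h3 := mul_le_mul_of_nonneg_left (hm1' (f y)) (mul_nonneg hδ (p1 y).le)
      linarith
    rw [Finset.sum_add_distrib, ← Finset.mul_sum, s1] at this
    linarith
  · have : ∑ y ∈ U, p y / q * m y ≤
        ∑ y ∈ U, (p' (f y) / q' * m' (f y) + (e + δ) * (p' (f y) / q')) :=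
      Finset.sum_le_sum fun y hy => by
      have h1 := mul_le_mul_of_nonneg_right (a2 y hy) (hm0 y)
      have h2 := mul_le_mul_of_nonneg_left (abs_le.1 (he y hy)).2 (p2 y).le
      have h3 := mul_le_mul_of_nonneg_left (hm1 y) (mul_nonneg hδ (p2 y).le)
      linarith
    rw [Finset.sum_add_distrib, ← Finset.mul_sum, s2] at this
    linarith

variable [Fintype V']

/-- The diameter of a set containing x is tested in R-balls at points within R of x; hence the
radius 2R. -/
theorem image_smallSets (h : IsCloseAt G p G' p' f r δ x) (hR : 2 * R ≤ r) :
    ((G.smallSets R).filter fun U => x ∈ U).image (fun U => U.image f) =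
      (G'.smallSets R).filter fun U' => f x ∈ U' := by
  ext U'
  simp only [Finset.mem_image, Finset.mem_filter]
  constructor
  · rintro ⟨U, ⟨hU, hx⟩, rfl⟩
    refine ⟨mem_smallSets.2 ⟨⟨f x, Finset.mem_image_of_mem f hx⟩, ?_⟩, Finset.mem_image_of_mem f hx⟩
    intro y' hy' z' hz'
    obtain ⟨y, hy, rfl⟩ := Finset.mem_image.1 hy'
    obtain ⟨z, hz, rfl⟩ := Finset.mem_image.1 hz'
    exact (h.mem_cball_iff (n := R) (subset_cball hU hx y hy)
      (cball_mono x (by omega) (subset_cball hU hx z hz)) (by omega)).2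
      ((mem_smallSets.1 hU).2 y hy z hz)
  · rintro ⟨hU', hx'⟩
    have hsub : ∀ y' ∈ U', ∃ y ∈ G.cball x R, f y = y' := fun y' hy' => by
      have : y' ∈ G'.cball (f x) R := subset_cball hU' hx' y' hy'
      rwa [← h.image_cball (mem_cball_self x 0) (by omega)] at this
    refine ⟨Finset.univ.filter fun y => y ∈ G.cball x R ∧ f y ∈ U', ⟨?_, ?_⟩, ?_⟩
    · refine mem_smallSets.2 ⟨⟨x, by simp [mem_cball_self, hx']⟩, fun y hy z hz => ?_⟩
      simp only [Finset.mem_filter, Finset.mem_univ, true_and] at hy hz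
      exact (h.mem_cball_iff (n := R) hy.1 (cball_mono x (by omega) hz.1) (by omega)).1
        ((mem_smallSets.1 hU').2 _ hy.2 _ hz.2)
    · simp [mem_cball_self, hx']
    · ext y'
      simp only [Finset.mem_image, Finset.mem_filter, Finset.mem_univ, true_and]
      constructor
      · rintro ⟨y, hy, rfl⟩; exact hy.2
      · intro hy'
        obtain ⟨y, hy, rfl⟩ := hsub y' hy'
        exact ⟨y, ⟨hy, hy'⟩, rfl⟩

theorem sum_smallSets (h : IsCloseAt G p G' p' f r δ x) (hR : 2 * R ≤ r) (F : Finset V' → ℝ) :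
    ∑ U' ∈ G'.smallSets R with f x ∈ U', F U' = ∑ U ∈ G.smallSets R with x ∈ U, F (U.image f) := by
  rw [← h.image_smallSets hR, Finset.sum_image]
  intro U hU W hW hUW
  have hsub : ∀ U ∈ (G.smallSets R).filter (fun U => x ∈ U), ∀ y ∈ U, y ∈ G.cball x r :=
    fun U hU y hy => cball_mono x (by omega) (subset_cball (Finset.mem_filter.1 hU).1
      (Finset.mem_filter.1 hU).2 y hy)
  have key : ∀ U ∈ (G.smallSets R).filter (fun U => x ∈ U),
      ∀ W ∈ (G.smallSets R).filter (fun U => x ∈ U), U.image f = W.image f → U ⊆ W := by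
    intro U hU W hW hUW y hy
    have : f y ∈ W.image f := hUW ▸ Finset.mem_image_of_mem f hy
    obtain ⟨z, hz, hzy⟩ := Finset.mem_image.1 this
    rwa [← h.bijOn.injOn (hsub W hW z hz) (hsub U hU y hy) hzy]
  exact (key U hU W hW hUW).antisymm (key W hW U hU hUW.symm)

end IsCloseAt

end SimpleGraph

/-! ### The local cost and its stability -/

namespace SimpleGraph

/-- The contribution of `x` to the average cost of the first `T` iterates. -/
noncomputable def localCost {V : Type} [Fintype V] (G : SimpleGraph V) (p : V → ℝ) (R : ℕ)
    (lam η : ℝ) (T : ℕ) (x : V) : ℝ :=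
  (∑ k ∈ Finset.range T, (∑ U ∈ G.smallSets R with x ∈ U,
    G.coverIter p R lam η k U * (G.indepWeight p U / ∑ y ∈ U, p y) +
      lam / 2 * G.slack R (G.coverIter p R lam η k) x ^ 2)) / T

section

variable {V : Type} [Fintype V] {G : SimpleGraph V}

/-- The cost w_U i(U) is distributed over the vertices of U in proportion to p, which turns the
global cost into an expectation. -/
theorem sum_mul_localCost {p : V → ℝ} (hp : ∀ v, 0 < p v) (R : ℕ) (lam η : ℝ) (T : ℕ) :
    ∑ x, p x * G.localCost p R lam η T x =
      (∑ k ∈ Finset.range T, G.coverCost p R lam (G.coverIter p R lam η k)) / T := by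
  simp only [localCost, mul_div_assoc', Finset.mul_sum]
  rw [← Finset.sum_div, Finset.sum_comm]
  congr 1
  refine Finset.sum_congr rfl fun k _ => ?_
  simp only [mul_add, Finset.sum_add_distrib, coverCost]
  rw [← G.sum_smallSets_sum_mem R]
  congr 1
  · refine Finset.sum_congr rfl fun U hU => ?_
    rw [div_mul_cancel₀ _ (sum_pos_of_mem_smallSets hp hU).ne']
  · rw [Finset.mul_sum]
    exact Finset.sum_congr rfl fun x _ => by ring

theorem localCost_mem_Icc {p : V → ℝ} (hp : ∀ v, 0 < p v) {R : ℕ} {lam η : ℝ} (hl : 0 < lam)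
    (hη : 0 < η) {M : ℕ} {x : V} (hM : ((G.smallSets R).filter fun U => x ∈ U).card ≤ M) {T : ℕ}
    (hT : 0 < T) : 0 ≤ G.localCost p R lam η T x ∧
      G.localCost p R lam η T x ≤ M * (T * (η * lam)) + lam / 2 := by
  have hT' : (0 : ℝ) < T := by exact_mod_cast hT
  have hq : ∀ U : Finset V, 0 ≤ ∑ y ∈ U, p y := fun U => Finset.sum_nonneg fun y _ => (hp y).le
  have h0 : ∀ U, 0 ≤ G.indepWeight p U / ∑ y ∈ U, p y := fun U =>
    div_nonneg (indepWeight_nonneg p U) (hq U)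
  have h1 : ∀ U, G.indepWeight p U / ∑ y ∈ U, p y ≤ 1 := fun U =>
    div_le_one_of_le₀ (indepWeight_le_sum hp U) (hq U)
  have hw := coverIter_nonneg (G := G) p R lam η
  rw [localCost]
  constructor
  · refine div_nonneg (Finset.sum_nonneg fun k _ => add_nonneg
      (Finset.sum_nonneg fun U _ => mul_nonneg (hw k U) (h0 U)) (by positivity)) hT'.le
  · rw [div_le_iff₀ hT']
    calc _ ≤ ∑ k ∈ Finset.range T, (M * (T * (η * lam)) + lam / 2) := by
          refine Finset.sum_le_sum fun k hk => add_le_add ?_ ?_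
          · calc _ ≤ ∑ U ∈ G.smallSets R with x ∈ U, T * (η * lam) := by
                  refine Finset.sum_le_sum fun U _ => ?_
                  have hkT : (k : ℝ) ≤ T := by exact_mod_cast (Finset.mem_range.1 hk).le
                  have : G.coverIter p R lam η k U ≤ T * (η * lam) :=
                    (coverIter_le hp hl hη k U).trans (by gcongr)
                  exact (mul_le_of_le_one_right (hw k U) (h1 U)).trans this
              _ ≤ _ := by
                  rw [Finset.sum_const, nsmul_eq_mul]
                  have : (((G.smallSets R).filter fun U => x ∈ U).card : ℝ) ≤ M := by
                    exact_mod_cast hM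
                  gcongr
          · refine mul_le_of_le_one_right (by positivity) ?_
            exact pow_le_one₀ (slack_nonneg _ _ _) (slack_le_one (hw k) x)
      _ = _ := by rw [Finset.sum_const, Finset.card_range, nsmul_eq_mul, mul_comm]

end

section stability

variable {V V' : Type} [Fintype V] [Fintype V'] {G : SimpleGraph V} {p : V → ℝ}
  {G' : SimpleGraph V'} {p' : V' → ℝ} {f : V → V'} {r R M : ℕ} {δ lam η e : ℝ} {x : V}

theorem IsCloseAt.abs_slack_sub_le (h : IsCloseAt G p G' p' f r δ x) (hR : 2 * R ≤ r)
    (hM : ((G.smallSets R).filter fun U => x ∈ U).card ≤ M) (he0 : 0 ≤ e) {w : Finset V → ℝ}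
    {w' : Finset V' → ℝ} (he : ∀ U ∈ G.smallSets R, x ∈ U → |w U - w' (U.image f)| ≤ e) :
    |G.slack R w x - G'.slack R w' (f x)| ≤ M * e := by
  have hc : |G.coverage R w x - G'.coverage R w' (f x)| ≤ M * e := by
    rw [coverage, coverage, h.sum_smallSets hR, ← Finset.sum_sub_distrib]
    refine (Finset.abs_sum_le_sum_abs _ _).trans ((Finset.sum_le_sum fun U hU =>
      he U (Finset.mem_filter.1 hU).1 (Finset.mem_filter.1 hU).2).trans ?_)
    rw [Finset.sum_const, nsmul_eq_mul]
    have : (((G.smallSets R).filter fun U => x ∈ U).card : ℝ) ≤ M := by exact_mod_cast hM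
    gcongr
  rw [slack, slack]
  refine (abs_max_sub_max_le_max _ _ _ _).trans (max_le (by simpa using (abs_nonneg _).trans hc) ?_)
  rw [sub_sub_sub_cancel_left, abs_sub_comm]
  exact hc

variable (R M lam η) in
/-- The iterates are continuous functions of the weighted balls. -/
theorem exists_abs_coverIter_sub_le (hl : 0 < lam) (hη : 0 < η) (k : ℕ) : ∀ ε : ℝ, 0 < ε →
    ∃ (r : ℕ) (δ : ℝ), 0 < δ ∧ ∀ {V V' : Type} [Fintype V] [Fintype V'] {G : SimpleGraph V}
      {p : V → ℝ} {G' : SimpleGraph V'} {p' : V' → ℝ} {f : V → V'} {x : V},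
      (∀ v, 0 < p v) → (∀ v, 0 < p' v) →
      (∀ x, ((G.smallSets R).filter fun U => x ∈ U).card ≤ M) → IsCloseAt G p G' p' f r δ x →
      ∀ U ∈ G.smallSets R, x ∈ U →
        |G.coverIter p R lam η k U - G'.coverIter p' R lam η k (U.image f)| ≤ ε := by
  induction k with
  | zero => exact fun ε hε => ⟨0, 1, one_pos, fun _ _ _ _ U _ _ => by simpa [coverIter] using hε.le⟩
  | succ k ih =>
    intro ε hε
    -- One step turns an error e into e(1 + ηλM) plus η(1 + λ)δ; each of the two parts is given ε/2.
    obtain ⟨r, δ, hδ, hk⟩ := ih (ε / (2 * (1 + η * lam * M))) (by positivity)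
    set e := ε / (2 * (1 + η * lam * M)) with he
    have he0 : 0 < e := by positivity
    -- R steps lead from x to any y in U; around y, radius r serves the previous iterate and 2R the
    -- small sets containing y.
    refine ⟨R + (r + 2 * R), min δ (ε / (2 * (η * (1 + lam)))), by positivity, ?_⟩
    intro V V' _ _ G p G' p' f x hp hp' hM h U hU hx
    set δ' := min δ (ε / (2 * (η * (1 + lam)))) with hδ'
    have hδ'0 : 0 < δ' := by positivity
    have hw := coverIter_nonneg (G := G) p R lam η k
    have hw' := coverIter_nonneg (G := G') p' R lam η k
    have hslack : ∀ y ∈ U, |G.slack R (G.coverIter p R lam η k) y -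
        G'.slack R (G'.coverIter p' R lam η k) (f y)| ≤ M * e := fun y hy => by
      have hc := h.recenter (n := r + 2 * R) (IsCloseAt.subset_cball hU hx y hy) le_rfl
      refine hc.abs_slack_sub_le (by omega) (hM y) he0.le fun W hW hyW => ?_
      exact hk hp hp' hM (hc.mono hp hp' (by omega) (min_le_left _ _)) W hW hyW
    have h1 := h.abs_indepWeight_sub_le hp hp' (by omega) hδ'0.le hU hx
    have h2 := h.abs_average_sub_le hp hp' (by omega) hδ'0.le hU hx
      (slack_nonneg _ _) (slack_le_one hw) (slack_nonneg _ _) (slack_le_one hw') hslack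
    have h3 := hk hp hp' hM (h.mono hp hp' (by omega) (min_le_left _ _)) U hU hx
    have hsplit : e + η * (δ' + lam * (M * e + δ')) ≤ ε := by
      have e1 : e * (1 + η * lam * M) = ε / 2 := by rw [he]; field_simp
      have e2 : η * (1 + lam) * δ' ≤ ε / 2 := by
        have : δ' ≤ ε / (2 * (η * (1 + lam))) := min_le_right _ _
        rw [le_div_iff₀ (by positivity)] at this
        linarith
      linarith
    refine le_trans ?_ hsplit
    simp only [coverIter]
    refine (abs_max_sub_max_le_max _ _ _ _).trans (max_le (by simpa using by positivity) ?_)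
    rw [abs_le] at h1 h2 h3 ⊢
    simp only [coverGrad]
    have m1 := mul_le_mul_of_nonneg_left h2.1 hl.le
    have m2 := mul_le_mul_of_nonneg_left h2.2 hl.le
    constructor
    · have t : G.indepWeight p U / ∑ y ∈ U, p y - G'.indepWeight p' (U.image f) /
          ∑ y ∈ U.image f, p' y - lam * ((∑ y ∈ U, p y * G.slack R (G.coverIter p R lam η k) y) /
          ∑ y ∈ U, p y - (∑ y ∈ U.image f, p' y * G'.slack R (G'.coverIter p' R lam η k) y) /
          ∑ y ∈ U.image f, p' y) ≤ δ' + lam * (M * e + δ') := by linarith [h1.2]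
      have t := mul_le_mul_of_nonneg_left t hη.le
      linarith [h3.1]
    · have t : -(δ' + lam * (M * e + δ')) ≤ G.indepWeight p U / ∑ y ∈ U, p y -
          G'.indepWeight p' (U.image f) /
          ∑ y ∈ U.image f, p' y - lam * ((∑ y ∈ U, p y * G.slack R (G.coverIter p R lam η k) y) /
          ∑ y ∈ U, p y - (∑ y ∈ U.image f, p' y * G'.slack R (G'.coverIter p' R lam η k) y) /
          ∑ y ∈ U.image f, p' y) := by linarith [h1.1]
      have t := mul_le_mul_of_nonneg_left t hη.le
      linarith [h3.2]

variable (R M lam η) in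
/-- The local cost is a continuous function of the weighted ball. -/
theorem exists_abs_localCost_sub_le (hl : 0 < lam) (hη : 0 < η) {T : ℕ} (hT : 0 < T) {ε : ℝ}
    (hε : 0 < ε) :
    ∃ (r : ℕ) (δ : ℝ), 0 < δ ∧ ∀ {V V' : Type} [Fintype V] [Fintype V'] {G : SimpleGraph V}
      {p : V → ℝ} {G' : SimpleGraph V'} {p' : V' → ℝ} {f : V → V'} {x : V},
      (∀ v, 0 < p v) → (∀ v, 0 < p' v) →
      (∀ x, ((G.smallSets R).filter fun U => x ∈ U).card ≤ M) → IsCloseAt G p G' p' f r δ x →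
        |G.localCost p R lam η T x - G'.localCost p' R lam η T (f x)| ≤ ε := by
  have hT' : (0 : ℝ) < T := by exact_mod_cast hT
  -- The errors of the iterates contribute (M + λM)e and those of the quotients i(U)/p(U) contribute
  -- MTηλδ₁, at most ε/2 each.
  set e := ε / (2 * (M + lam * M + 1)) with he
  have he0 : 0 < e := by positivity
  choose r δ hδ hk using fun k => exists_abs_coverIter_sub_le R M lam η hl hη k e he0
  set δ₀ := (Finset.range T).inf' ⟨0, Finset.mem_range.2 hT⟩ δ with hδ₀
  have hδ₀0 : 0 < δ₀ := (Finset.lt_inf'_iff _).2 fun k _ => hδ k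
  set δ₁ := ε / (2 * (M * (T * (η * lam)) + 1)) with hδ₁
  have hδ₁0 : 0 < δ₁ := by positivity
  refine ⟨(Finset.range T).sup r + 2 * R, min δ₀ δ₁, lt_min hδ₀0 hδ₁0, ?_⟩
  intro V V' _ _ G p G' p' f x hp hp' hM h
  have hmin : 0 < min δ₀ δ₁ := lt_min hδ₀0 hδ₁0
  have hsum : ∀ k ∈ Finset.range T, |(∑ U ∈ G.smallSets R with x ∈ U,
      G.coverIter p R lam η k U * (G.indepWeight p U / ∑ y ∈ U, p y) +
      lam / 2 * G.slack R (G.coverIter p R lam η k) x ^ 2) -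
      (∑ U ∈ G'.smallSets R with f x ∈ U,
      G'.coverIter p' R lam η k U * (G'.indepWeight p' U / ∑ y ∈ U, p' y) +
      lam / 2 * G'.slack R (G'.coverIter p' R lam η k) (f x) ^ 2)| ≤ ε := by
    intro k hkT
    have hr : r k ≤ (Finset.range T).sup r := Finset.le_sup hkT
    have hdk : min δ₀ δ₁ ≤ δ k := (min_le_left _ _).trans (Finset.inf'_le _ hkT)
    have hit := hk k hp hp' hM (h.mono hp hp' (by omega) hdk)
    have hw := coverIter_nonneg (G := G) p R lam η k
    have hw' := coverIter_nonneg (G := G') p' R lam η k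
    have hs := h.abs_slack_sub_le (by omega) (hM x) he0.le hit
    have hs2 : |lam / 2 * G.slack R (G.coverIter p R lam η k) x ^ 2 -
        lam / 2 * G'.slack R (G'.coverIter p' R lam η k) (f x) ^ 2| ≤ lam * (M * e) := by
      have b1 := slack_nonneg (G := G) R (G.coverIter p R lam η k) x
      have b2 := slack_le_one (G := G) (R := R) hw x
      have b3 := slack_nonneg (G := G') R (G'.coverIter p' R lam η k) (f x)
      have b4 := slack_le_one (G := G') (R := R) hw' (f x)
      rw [← mul_sub, sq_sub_sq, abs_mul, abs_mul, abs_of_pos (by positivity : 0 < lam / 2),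
        abs_of_nonneg (by linarith)]
      calc _ ≤ lam / 2 * (2 * (M * e)) := by gcongr; linarith
        _ = _ := by ring
    have ht : |∑ U ∈ G.smallSets R with x ∈ U,
        G.coverIter p R lam η k U * (G.indepWeight p U / ∑ y ∈ U, p y) -
        ∑ U ∈ G'.smallSets R with f x ∈ U,
        G'.coverIter p' R lam η k U * (G'.indepWeight p' U / ∑ y ∈ U, p' y)| ≤
        M * (e + T * (η * lam) * δ₁) := by
      rw [h.sum_smallSets (by omega), ← Finset.sum_sub_distrib]
      refine (Finset.abs_sum_le_sum_abs _ _).trans ((Finset.sum_le_sum (g := fun _ =>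
        e + T * (η * lam) * δ₁) fun U hU => ?_).trans ?_)
      · obtain ⟨hU, hx⟩ := Finset.mem_filter.1 hU
        have h1 := h.abs_indepWeight_sub_le hp hp' (by omega) hmin.le hU hx
        have h2 := hit U hU hx
        have h3 : G.coverIter p R lam η k U ≤ T * (η * lam) := by
          refine (coverIter_le hp hl hη k U).trans ?_
          have : (k : ℝ) ≤ T := by exact_mod_cast (Finset.mem_range.1 hkT).le
          gcongr
        have h4 : G'.indepWeight p' (U.image f) / ∑ y ∈ U.image f, p' y ≤ 1 :=
          div_le_one_of_le₀ (indepWeight_le_sum hp' _) (Finset.sum_nonneg fun y _ => (hp' y).le)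
        have h5 : 0 ≤ G'.indepWeight p' (U.image f) / ∑ y ∈ U.image f, p' y :=
          div_nonneg (indepWeight_nonneg p' _) (Finset.sum_nonneg fun y _ => (hp' y).le)
        set a := G.coverIter p R lam η k U
        set a' := G'.coverIter p' R lam η k (U.image f)
        set b := G.indepWeight p U / ∑ y ∈ U, p y
        set b' := G'.indepWeight p' (U.image f) / ∑ y ∈ U.image f, p' y
        have : a * b - a' * b' = (a - a') * b' + a * (b - b') := by ring
        rw [this]
        refine (abs_add_le _ _).trans (add_le_add ?_ ?_)
        · rw [abs_mul, abs_of_nonneg h5]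
          exact (mul_le_of_le_one_right (abs_nonneg _) h4).trans h2
        · rw [abs_mul, abs_of_nonneg (hw U)]
          exact mul_le_mul h3 (h1.trans (min_le_right _ _)) (abs_nonneg _) (by positivity)
      · rw [Finset.sum_const, nsmul_eq_mul]
        have : (((G.smallSets R).filter fun U => x ∈ U).card : ℝ) ≤ M := by exact_mod_cast hM x
        gcongr
    have f1 : (M + lam * M + 1) * e = ε / 2 := by rw [he]; field_simp
    have f2 : (M * (T * (η * lam)) + 1) * δ₁ = ε / 2 := by rw [hδ₁]; field_simp
    rw [add_sub_add_comm]
    refine (abs_add_le _ _).trans ((add_le_add ht hs2).trans ?_)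
    linarith
  rw [localCost, localCost, ← sub_div, ← Finset.sum_sub_distrib, abs_div, abs_of_pos hT',
    div_le_iff₀ hT']
  refine (Finset.abs_sum_le_sum_abs _ _).trans ((Finset.sum_le_sum hsum).trans ?_)
  rw [Finset.sum_const, Finset.card_range, nsmul_eq_mul, mul_comm]

end stability

end SimpleGraph

/-! ### Independent sampling -/

section sampling

variable {V : Type} [Fintype V]

/-- Variances of independent samples add: on splitting off one sample the cross term vanishes, as h
has mean zero. -/
theorem sum_prod_mul_sq_sum (p h : V → ℝ) (hp : ∑ v, p v = 1) (hh : ∑ v, p v * h v = 0) (C : ℕ) :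
    ∑ s : Fin C → V, (∏ j, p (s j)) * (∑ j, h (s j)) ^ 2 = C * ∑ v, p v * h v ^ 2 := by
  induction C with
  | zero => simp
  | succ C ih =>
    have h1 : ∑ s : Fin C → V, ∏ j, p (s j) = 1 := by
      rw [← Fintype.sum_pow, hp, one_pow]
    rw [← (Fin.consEquiv fun _ => V).sum_comp, Fintype.sum_prod_type]
    simp only [Fin.consEquiv, Equiv.coe_fn_mk, Fin.prod_univ_succ, Fin.sum_univ_succ, Fin.cons_zero,
      Fin.cons_succ]
    have h2 : ∀ v, ∑ s : Fin C → V, p v * (∏ j, p (s j)) * (h v + ∑ j, h (s j)) ^ 2 =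
        p v * h v ^ 2 + 2 * (p v * h v) * ∑ s : Fin C → V, (∏ j, p (s j)) * ∑ j, h (s j) +
          p v * (C * ∑ v, p v * h v ^ 2) := fun v => by
      rw [← ih, Finset.mul_sum, Finset.mul_sum]
      have : p v * h v ^ 2 = ∑ s : Fin C → V, p v * h v ^ 2 * ∏ j, p (s j) := by
        rw [← Finset.mul_sum, h1, mul_one]
      rw [this, ← Finset.sum_add_distrib, ← Finset.sum_add_distrib]
      exact Finset.sum_congr rfl fun s _ => by ring
    rw [Finset.sum_congr rfl fun v _ => h2 v, Finset.sum_add_distrib, Finset.sum_add_distrib,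
      ← Finset.sum_mul, ← Finset.mul_sum, ← Finset.sum_mul, hp, hh]
    push_cast
    ring

end sampling

theorem sampleProb_mono {G : FinGraph} {p : G.V → ℝ} (hp : ∀ v, 0 < p v) {C : ℕ}
    {E F : (Fin C → G.V) → Prop} (h : ∀ s, E s → F s) :
    sampleProb G p C E ≤ sampleProb G p C F := by
  refine Finset.sum_le_sum fun s _ => ?_
  have h0 : 0 ≤ ∏ j, p (s j) := Finset.prod_nonneg fun j _ => (hp _).le
  by_cases hE : E s
  · simp [hE, h s hE]
  · rw [if_neg hE]; split_ifs <;> simp [h0]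

/-- Chebyshev's inequality for independent samples. -/
theorem lt_sampleProb {G : FinGraph} {p : G.V → ℝ} (hp : ∀ v, 0 < p v) (hp1 : ∑ v, p v = 1)
    {g : G.V → ℝ} {B a ε : ℝ} (hg : ∀ v, 0 ≤ g v ∧ g v ≤ B) (ha : 0 < a) {C : ℕ} (hC0 : 0 < C)
    (hC : B ^ 2 < ε * a ^ 2 * C) :
    1 - ε < sampleProb G p C fun s => |∑ v, p v * g v - (∑ j, g (s j)) / C| < a := by
  have hC' : (0 : ℝ) < C := by exact_mod_cast hC0
  set μ := ∑ v, p v * g v with hμ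
  have hμ0 : 0 ≤ μ := Finset.sum_nonneg fun v _ => mul_nonneg (hp v).le (hg v).1
  have hμB : μ ≤ B := by
    calc μ ≤ ∑ v, p v * B := Finset.sum_le_sum fun v _ =>
          mul_le_mul_of_nonneg_left (hg v).2 (hp v).le
      _ = B := by rw [← Finset.sum_mul, hp1, one_mul]
  have hmean : ∑ v, p v * (g v - μ) = 0 := by
    simp_rw [mul_sub]
    rw [Finset.sum_sub_distrib, ← Finset.sum_mul, hp1, ← hμ]; ring
  have hvar : ∑ v, p v * (g v - μ) ^ 2 ≤ B ^ 2 := by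
    calc _ ≤ ∑ v, p v * B ^ 2 := Finset.sum_le_sum fun v _ => by
          refine mul_le_mul_of_nonneg_left (sq_le_sq' ?_ ?_) (hp v).le
          · linarith [(hg v).1]
          · linarith [(hg v).2]
      _ = B ^ 2 := by rw [← Finset.sum_mul, hp1, one_mul]
  have hmom := sum_prod_mul_sq_sum p (fun v => g v - μ) hp1 hmean C
  have htot : ∑ s : Fin C → G.V, ∏ j, p (s j) = 1 := by
    rw [← Fintype.sum_pow, hp1, one_pow]
  have hprod : ∀ s : Fin C → G.V, 0 ≤ ∏ j, p (s j) := fun s =>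
    Finset.prod_nonneg fun j _ => (hp _).le
  -- The indicator of a small deviation is at least 1 − (deviation)²/(aC)².
  have hpt : ∀ s : Fin C → G.V, ∏ j, p (s j) -
      (∏ j, p (s j)) * (∑ j, (g (s j) - μ)) ^ 2 / (a ^ 2 * C ^ 2) ≤
      if |μ - (∑ j, g (s j)) / C| < a then ∏ j, p (s j) else 0 := fun s => by
    split_ifs with h
    · have := hprod s
      have : 0 ≤ (∏ j, p (s j)) * (∑ j, (g (s j) - μ)) ^ 2 / (a ^ 2 * C ^ 2) := by positivity
      linarith
    · rw [sub_nonpos, mul_div_assoc]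
      refine le_mul_of_one_le_right (hprod s) ?_
      rw [one_le_div (by positivity), ← mul_pow]
      have e : ∑ j, (g (s j) - μ) = -((μ - (∑ j, g (s j)) / C) * C) := by
        rw [Finset.sum_sub_distrib, Finset.sum_const, Finset.card_univ, Fintype.card_fin,
          nsmul_eq_mul, sub_mul, div_mul_cancel₀ _ hC'.ne']
        ring
      rw [e, neg_sq, mul_pow, mul_pow]
      refine mul_le_mul_of_nonneg_right ?_ (by positivity)
      rw [← sq_abs (μ - _)]
      exact pow_le_pow_left₀ ha.le (not_lt.1 h) 2
  have hsum := Finset.sum_le_sum fun s (_ : s ∈ Finset.univ) => hpt s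
  rw [Finset.sum_sub_distrib, ← Finset.sum_div, hmom, htot] at hsum
  refine lt_of_lt_of_le ?_ hsum
  have h3 : C * (∑ v, p v * (g v - μ) ^ 2) / (a ^ 2 * C ^ 2) < ε := by
    rw [div_lt_iff₀ (by positivity)]
    calc C * (∑ v, p v * (g v - μ) ^ 2) ≤ C * B ^ 2 := by gcongr
      _ < C * (ε * a ^ 2 * C) := by gcongr
      _ = _ := by ring
  linarith

theorem indepNumber_eq (G : FinGraph) (p : G.V → ℝ) :
    indepNumber G p = G.graph.indepWeight p Finset.univ := by
  refine IsGreatest.csSup_eq ⟨?_, ?_⟩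
  · obtain ⟨I, -, hI, h⟩ := G.graph.exists_indepWeight_eq p Finset.univ
    exact ⟨I, hI, h⟩
  · rintro _ ⟨I, hI, rfl⟩
    exact SimpleGraph.le_indepWeight p (Finset.subset_univ _) hI

/-! ### Bounded degree, bounded ratios and oracle answers -/

namespace FinGraph

variable {G : FinGraph} {d : ℕ}

theorem DegreeBounded.ncard_cball_le (hd : G.DegreeBounded d) (x : G.V) (r : ℕ) :
    (G.graph.cball x r).ncard ≤ (d + 1) ^ r := by
  induction r with
  | zero =>
    have : G.graph.cball x 0 = {x} := by
      ext y; rw [SimpleGraph.mem_cball_zero]; rfl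
    simp [this]
  | succ r ih =>
    have hsub : G.graph.cball x (r + 1) ⊆
        ⋃ y ∈ (G.graph.cball x r).toFinset, insert y (G.graph.neighborSet y) := by
      intro z hz
      simp only [Set.mem_iUnion, Set.mem_toFinset]
      rcases SimpleGraph.mem_cball_succ.1 hz with h | ⟨y, hy, hyz⟩
      · exact ⟨z, h, Set.mem_insert _ _⟩
      · exact ⟨y, hy, Set.mem_insert_of_mem _ hyz⟩
    refine (Set.ncard_le_ncard hsub (Set.toFinite _)).trans ?_
    refine (Finset.set_ncard_biUnion_le _ _).trans ?_
    refine (Finset.sum_le_card_nsmul _ _ (d + 1) fun y _ => ?_).trans ?_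
    · exact (Set.ncard_insert_le _ _).trans (Nat.add_le_add_right (hd y) 1)
    · rw [smul_eq_mul, ← Set.ncard_eq_toFinset_card', pow_succ]
      exact Nat.mul_le_mul_right _ ih

theorem DegreeBounded.card_smallSets_le (hd : G.DegreeBounded d) (R : ℕ) (x : G.V) :
    ((G.graph.smallSets R).filter fun U => x ∈ U).card ≤ 2 ^ (d + 1) ^ R := by
  have hsub : ((G.graph.smallSets R).filter fun U => x ∈ U) ⊆
      (G.graph.cball x R).toFinset.powerset := fun U hU => by
    obtain ⟨h1, h2⟩ := Finset.mem_filter.1 hU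
    rw [Finset.mem_powerset]
    intro y hy
    rw [Set.mem_toFinset]
    exact (SimpleGraph.mem_smallSets.1 h1).2 x h2 y hy
  refine (Finset.card_le_card hsub).trans ?_
  rw [Finset.card_powerset, ← Set.ncard_eq_toFinset_card']
  exact Nat.pow_le_pow_right two_pos (hd.ncard_cball_le x R)

end FinGraph

namespace IsKWeight

variable {G : FinGraph} {K : ℝ} {p : G.V → ℝ}

theorem mono (h : IsKWeight G K p) (hK : 0 < K) {L : ℝ} (hL : K ≤ L) : IsKWeight G L p :=
  ⟨h.pos, h.sum_eq_one, fun v w hvw => ⟨(one_div_le_one_div_of_le hK hL).trans (h.ratio v w hvw).1,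
    (h.ratio v w hvw).2.trans hL⟩⟩

theorem le_mul_of_mem_cball (h : IsKWeight G K p) (hK : 1 ≤ K) {x y : G.V} {r : ℕ}
    (hy : y ∈ G.graph.cball x r) : p y ≤ K ^ r * p x ∧ p x ≤ K ^ r * p y := by
  induction r generalizing y with
  | zero =>
    rw [SimpleGraph.mem_cball_zero] at hy
    simp [hy]
  | succ r ih =>
    have hKr : K ^ r ≤ K ^ (r + 1) := pow_le_pow_right₀ hK r.le_succ
    rcases SimpleGraph.mem_cball_succ.1 hy with h1 | ⟨u, hu, huy⟩
    · exact ⟨(ih h1).1.trans (mul_le_mul_of_nonneg_right hKr (h.pos _).le),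
        (ih h1).2.trans (mul_le_mul_of_nonneg_right hKr (h.pos _).le)⟩
    · have h2 := (h.ratio u y huy).2
      have h3 := (h.ratio y u huy.symm).2
      rw [div_le_iff₀ (h.pos _)] at h2 h3
      have hK0 : 0 ≤ K ^ r := by positivity
      rw [pow_succ]
      constructor
      · calc p y ≤ K * p u := h3
          _ ≤ K * (K ^ r * p x) := by gcongr; exact (ih hu).1
          _ = _ := by ring
      · calc p x ≤ K ^ r * p u := (ih hu).2
          _ ≤ K ^ r * (K * p y) := by gcongr
          _ = _ := by ring

end IsKWeight

theorem abs_sub_lt_of_truncate_eq {t : ℕ} {a b : ℝ} (h : truncate t a = truncate t b) :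
    |a - b| < 1 / 10 ^ t := by
  have h10 : (0 : ℝ) < 10 ^ t := by positivity
  have hq : (10 : ℚ) ^ t ≠ 0 := by positivity
  rw [truncate, truncate, div_left_inj' hq] at h
  have h' : ⌊(10 : ℝ) ^ t * a⌋ = ⌊(10 : ℝ) ^ t * b⌋ := by exact_mod_cast h
  have := Int.abs_sub_lt_one_of_floor_eq_floor h'
  rw [← mul_sub, abs_mul, abs_of_pos h10] at this
  rw [lt_div_iff₀ h10]; linarith

/-- Equal query results of large depth are witnessed by a nearly weight preserving isomorphism of
balls. -/
theorem exists_isCloseAt_of_oracleQuery_eq {G G' : FinGraph} {K : ℝ} (hK : 1 ≤ K) {p : G.V → ℝ}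
    {p' : G'.V → ℝ} (hp : IsKWeight G K p) (hp' : IsKWeight G' K p') {r t : ℕ} {δ : ℝ}
    (hδ1 : K ^ r / 10 ^ t ≤ 1) (hδ : K ^ r / 10 ^ t ≤ δ / 3) {x : G.V} {x' : G'.V}
    (h : oracleQuery G p r t x = oracleQuery G' p' r t x') :
    ∃ f : G.V → G'.V, f x = x' ∧ G.graph.IsCloseAt p G'.graph p' f r δ x := by
  have hx : x ∈ G.graph.cball x r := SimpleGraph.mem_cball_self x r
  obtain ⟨e, he, hl⟩ : ∃ e : G.graph.induce (G.graph.cball x r) ≃g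
      G'.graph.induce (G'.graph.cball x' r),
      e ⟨x, hx⟩ = ⟨x', SimpleGraph.mem_cball_self x' r⟩ ∧
      ∀ v : G.graph.cball x r, truncate t (p' (e v) / p' x') = truncate t (p v / p x) :=
    Quotient.exact h
  -- The value outside the ball is arbitrary.
  let f : G.V → G'.V := fun y => if hy : y ∈ G.graph.cball x r then e ⟨y, hy⟩ else x'
  have hf : ∀ y (hy : y ∈ G.graph.cball x r), f y = e ⟨y, hy⟩ := fun y hy => dif_pos hy
  have hfx : f x = x' := by rw [hf x hx, he]
  refine ⟨f, hfx, ⟨⟨?_, ?_, ?_⟩, ?_, ?_⟩⟩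
  · intro y hy
    rw [hf y hy, hfx]
    exact (e ⟨y, hy⟩).2
  · intro y hy z hz hyz
    rw [hf y hy, hf z hz] at hyz
    exact congrArg Subtype.val (e.injective (Subtype.ext hyz))
  · intro y' hy'
    rw [hfx] at hy'
    refine ⟨e.symm ⟨y', hy'⟩, (e.symm ⟨y', hy'⟩).2, ?_⟩
    rw [hf _ (e.symm ⟨y', hy'⟩).2]
    exact congrArg Subtype.val (e.apply_symm_apply ⟨y', hy'⟩)
  · intro y hy z hz
    rw [hf y hy, hf z hz]
    exact e.map_rel_iff (a := ⟨y, hy⟩) (b := ⟨z, hz⟩)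
  · set σ := K ^ r / 10 ^ t with hσ
    have hσ0 : 0 ≤ σ := by positivity
    -- Quotients in the ball are at least K⁻ʳ, so the truncation error 10⁻ᵗ is a relative error of
    -- at most σ. Two such factors suffice below, because (1 + σ)² ≤ 1 + 3σ ≤ 1 + δ for σ ≤ 1.
    have key : ∀ y ∈ G.graph.cball x r,
        p' (f y) / p' x' ≤ (1 + σ) * (p y / p x) ∧ p y / p x ≤ (1 + σ) * (p' (f y) / p' x') := by
      intro y hy
      have h1 := abs_lt.1 (abs_sub_lt_of_truncate_eq (hl ⟨y, hy⟩))
      rw [← hf y hy] at h1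
      have h2 := (hp.le_mul_of_mem_cball hK hy).2
      have hy' : f y ∈ G'.graph.cball x' r := by rw [hf y hy]; exact (e ⟨y, hy⟩).2
      have h3 := (hp'.le_mul_of_mem_cball hK hy').2
      have e1 : 1 ≤ K ^ r * (p y / p x) := by
        rw [mul_div_assoc', one_le_div (hp.pos x)]; exact h2
      have e2 : 1 ≤ K ^ r * (p' (f y) / p' x') := by
        rw [mul_div_assoc', one_le_div (hp'.pos x')]; exact h3
      have i0 : (0 : ℝ) ≤ 1 / 10 ^ t := by positivity
      have e3 := mul_le_mul_of_nonneg_left e1 i0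
      have e4 := mul_le_mul_of_nonneg_left e2 i0
      have e5 : σ = 1 / 10 ^ t * K ^ r := by rw [hσ]; ring
      rw [e5]
      dsimp only at h1
      constructor <;> nlinarith [h1.1, h1.2]
    intro y hy z hz
    have hy1 := (key y hy).1
    have hz2 := (key z hz).2
    have hpx := hp.pos x
    have hpx' := hp'.pos x'
    have hpos1 : 0 < p y / p x := div_pos (hp.pos y) hpx
    have hpos2 : 0 < p' (f z) / p' x' := div_pos (hp'.pos _) hpx'
    have hprod : p' (f y) / p' x' * (p z / p x) ≤
        (1 + δ) * (p y / p x * (p' (f z) / p' x')) := by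
      calc _ ≤ (1 + σ) * (p y / p x) * ((1 + σ) * (p' (f z) / p' x')) :=
            mul_le_mul hy1 hz2 (div_pos (hp.pos z) hpx).le (by positivity)
        _ = (1 + σ) ^ 2 * (p y / p x * (p' (f z) / p' x')) := by ring
        _ ≤ _ := by
          refine mul_le_mul_of_nonneg_right ?_ (by positivity)
          nlinarith
    have hc := mul_le_mul_of_nonneg_right hprod (mul_pos hpx hpx').le
    have l1 : p' (f y) / p' x' * (p z / p x) * (p x * p' x') = p' (f y) * p z := by
      field_simp
    have l2 : (1 + δ) * (p y / p x * (p' (f z) / p' x')) * (p x * p' x') =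
        (1 + δ) * (p y * p' (f z)) := by
      field_simp
    rwa [l1, l2] at hc

/-- Only finitely many query results occur. -/
theorem finite_oracleQuery (d r t : ℕ) {K : ℝ} (hK : 1 ≤ K) :
    {q : QueryResult | ∃ (G : FinGraph) (p : G.V → ℝ) (x : G.V), G.DegreeBounded d ∧
      IsKWeight G K p ∧ q = oracleQuery G p r t x}.Finite := by
  -- All possible labels, since quotients of weights in an r-ball lie in (0, Kʳ]. With at most (d +
  -- 1)ʳ vertices per ball, finitely many models on `Fin n` remain.
  let L : Finset ℚ := (Finset.Icc (0 : ℤ) ⌊(10 : ℝ) ^ t * K ^ r⌋).image fun n : ℤ => (n : ℚ) / 10 ^ t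
  let Φ : (Σ n : Fin ((d + 1) ^ r + 1), SimpleGraph (Fin n) × Fin n × (Fin n → L)) →
      QueryResult := fun a => Quotient.mk RootedLabeledGraph.setoid
    { V := Fin a.1, graph := a.2.1, root := a.2.2.1, label := fun v => a.2.2.2 v }
  refine (Set.finite_range Φ).subset ?_
  rintro _ ⟨G, p, x, hd, hp, rfl⟩
  have hcard : Nat.card (G.graph.cball x r) < (d + 1) ^ r + 1 :=
    Nat.lt_succ_of_le (hd.ncard_cball_le x r)
  let φ : Fin (Nat.card (G.graph.cball x r)) ≃ G.graph.cball x r := (Finite.equivFin _).symm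
  have hL : ∀ y : G.graph.cball x r, truncate t (p y / p x) ∈ L := fun y => by
    refine Finset.mem_image.2 ⟨⌊(10 : ℝ) ^ t * (p y / p x)⌋, Finset.mem_Icc.2 ⟨?_, ?_⟩, rfl⟩
    · have := div_pos (hp.pos y) (hp.pos x)
      exact Int.floor_nonneg.2 (by positivity)
    · refine Int.floor_le_floor (mul_le_mul_of_nonneg_left ?_ (by positivity))
      rw [div_le_iff₀ (hp.pos x)]
      exact (hp.le_mul_of_mem_cball hK y.2).1
  refine ⟨⟨⟨_, hcard⟩, (G.graph.induce (G.graph.cball x r)).comap φ,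
    φ.symm ⟨x, SimpleGraph.mem_cball_self x r⟩, fun v => ⟨_, hL (φ v)⟩⟩, ?_⟩
  refine Quotient.sound ⟨SimpleGraph.Iso.comap φ _, ?_, fun v => rfl⟩
  exact φ.apply_symm_apply _

/-! ### The tester -/

/-- The independence number is testable in weighted hyperfinite classes of bounded degree. -/
theorem indepNumberTestable_of_weightedHyperfinite {d : ℕ} {𝒢 : Set FinGraph}
    (hd : ∀ G ∈ 𝒢, G.DegreeBounded d) (hWH : WeightedHyperfinite 𝒢) : IndepNumberTestable 𝒢 := by
  intro ε K₀ hε hK₀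
  set K := max K₀ 1
  have hK : 1 ≤ K := le_max_right _ _
  -- λ, the measure of Y, η and T are chosen so that each of the four terms of the optimization
  -- error is at most ε/16. Optimization, sampling and table then cost ε/4 each.
  set lam := 8 / ε with hlam
  have hl : 0 < lam := by positivity
  obtain ⟨R, hR⟩ := hWH (ε / (8 * lam)) (by positivity)
  set M := 2 ^ (d + 1) ^ R with hM
  have hM0 : (0 : ℝ) < M := by rw [hM]; positivity
  set η := ε / (8 * (1 + lam) ^ 2 * M) with hη
  have hη0 : 0 < η := by positivity
  obtain ⟨T, hT⟩ := exists_nat_gt (8 / (η * ε))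
  have hT0' : (0 : ℝ) < T := (by positivity : 0 < 8 / (η * ε)).trans hT
  have hT0 : 0 < T := by exact_mod_cast hT0'
  obtain ⟨r, δ, hδ, hclose⟩ := SimpleGraph.exists_abs_localCost_sub_le R M lam η hl hη0 hT0
    (by positivity : 0 < ε / 8)
  obtain ⟨t, ht⟩ := pow_unbounded_of_one_lt (K ^ (r + 1) / min 1 (δ / 3)) (by norm_num : (1 : ℝ) < 10)
  have ht' : K ^ (r + 1) / 10 ^ (t + 1) ≤ min 1 (δ / 3) := by
    have hmin : 0 < min 1 (δ / 3) := by positivity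
    rw [div_lt_iff₀ hmin] at ht
    rw [div_le_iff₀ (by positivity), pow_succ (10 : ℝ)]
    nlinarith [pow_pos (by norm_num : (0 : ℝ) < 10) t]
  set B : ℝ := M * (T * (η * lam)) + lam / 2 with hB
  obtain ⟨C, hC⟩ := exists_nat_gt (B ^ 2 / (ε * (ε / 4) ^ 2))
  have hC0' : (0 : ℝ) < C := lt_of_le_of_lt (by positivity) hC
  have hC0 : 0 < C := by exact_mod_cast hC0'
  -- the lookup table for one query
  set Q : Set QueryResult := {q | ∃ (G : FinGraph) (p : G.V → ℝ) (x : G.V), G.DegreeBounded d ∧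
      IsKWeight G K p ∧ q = oracleQuery G p (r + 1) (t + 1) x} with hQ
  have hQfin : Q.Finite := finite_oracleQuery d (r + 1) (t + 1) hK
  -- One weighted graph realizing q is fixed and its local cost is rounded to a rational within ε/8.
  -- Any other realization has a nearly isomorphic ball, so its local cost differs from the fixed
  -- one by at most ε/8.
  have hrep : ∀ q : QueryResult, ∃ c : ℚ, ∀ (G : FinGraph) (p : G.V → ℝ) (x : G.V),
      G.DegreeBounded d → IsKWeight G K p → q = oracleQuery G p (r + 1) (t + 1) x →
      |G.graph.localCost p R lam η T x - c| ≤ ε / 4 := by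
    intro q
    by_cases hq : q ∈ Q
    · obtain ⟨G, p, x, hG, hp, rfl⟩ := hq
      obtain ⟨c, hc1, hc2⟩ := exists_rat_btwn (show G.graph.localCost p R lam η T x <
        G.graph.localCost p R lam η T x + ε / 8 by linarith)
      refine ⟨c, fun G' p' x' _ hp' he => ?_⟩
      obtain ⟨f, rfl, hf⟩ := exists_isCloseAt_of_oracleQuery_eq hK hp hp'
        (ht'.trans (min_le_left _ _)) (ht'.trans (min_le_right _ _)) he
      have := hclose hp.pos hp'.pos (hG.card_smallSets_le R)
        (hf.mono hp.pos hp'.pos r.le_succ le_rfl)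
      rw [abs_le] at this ⊢
      constructor <;> linarith [this.1, this.2]
    · exact ⟨0, fun G p x hG hp he => absurd ⟨G, p, x, hG, hp, he⟩ hq⟩
  choose c hc using hrep
  let table : (Fin C → QueryResult) → ℚ := fun q => if ∀ j, q j ∈ Q then (∑ j, c (q j)) / C else 0
  have htable : (Function.support table).Finite := by
    refine (Set.Finite.pi' fun _ : Fin C => hQfin).subset fun q hq => ?_
    by_contra hne
    exact hq (if_neg hne)
  refine ⟨t + 1, r + 1, C, Finsupp.ofSupportFinite table htable, t.succ_pos, r.succ_pos, hC0, ?_⟩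
  intro G hG p hp₀
  have hp : IsKWeight G K p := hp₀.mono hK₀ (le_max_left _ _)
  obtain ⟨Y, s, hY, hs, hsR⟩ := hR G hG p hp.pos hp.sum_eq_one
  have hopt := SimpleGraph.abs_average_coverCost_sub_le hp.pos hp.sum_eq_one hl hη0
    ((hd G hG).card_smallSets_le R) hs hsR hT0
  rw [← indepNumber_eq, ← SimpleGraph.sum_mul_localCost hp.pos] at hopt
  have herr : 1 / (2 * lam) + lam / 2 * ∑ x ∈ Y, p x + 1 / (2 * η * T) +
      η * (1 + lam) ^ 2 * M / 2 ≤ ε / 4 := by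
    have e1 : 1 / (2 * lam) = ε / 16 := by rw [hlam]; field_simp; norm_num
    have e2 : lam / 2 * ∑ x ∈ Y, p x ≤ ε / 16 := by
      rw [le_div_iff₀ (by positivity)] at hY
      linarith
    have e3 : 1 / (2 * η * T) ≤ ε / 16 := by
      rw [div_lt_iff₀ (by positivity)] at hT
      rw [div_le_iff₀ (by positivity)]
      linarith
    have e4 : η * (1 + lam) ^ 2 * M / 2 = ε / 16 := by
      rw [hη]; field_simp; norm_num
    linarith
  have hsamp := lt_sampleProb hp.pos hp.sum_eq_one (g := G.graph.localCost p R lam η T) (B := B)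
    (a := ε / 4) (ε := ε) (C := C)
    (fun x => SimpleGraph.localCost_mem_Icc hp.pos hl hη0 ((hd G hG).card_smallSets_le R x) hT0)
    (by positivity) hC0 (by rw [div_lt_iff₀ (by positivity)] at hC; linarith)
  refine hsamp.trans_le (sampleProb_mono hp.pos fun s hs => ?_)
  have hval : ((Finsupp.ofSupportFinite table htable
      (fun j => oracleQuery G p (r + 1) (t + 1) (s j)) : ℚ) : ℝ) =
      (∑ j, (c (oracleQuery G p (r + 1) (t + 1) (s j)) : ℝ)) / C := by
    -- The default value 0 of the table is never used on graphs of the class.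
    have : ∀ j, oracleQuery G p (r + 1) (t + 1) (s j) ∈ Q := fun j => ⟨G, p, s j, hd G hG, hp, rfl⟩
    rw [Finsupp.ofSupportFinite_coe]
    simp only [table, if_pos this]
    push_cast
    rfl
  have hdiff : |(∑ j, G.graph.localCost p R lam η T (s j)) / C -
      (∑ j, (c (oracleQuery G p (r + 1) (t + 1) (s j)) : ℝ)) / C| ≤ ε / 4 := by
    rw [← sub_div, ← Finset.sum_sub_distrib, abs_div, abs_of_pos hC0', div_le_iff₀ hC0']
    refine (Finset.abs_sum_le_sum_abs _ _).trans ((Finset.sum_le_sum fun j _ =>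
      hc _ G p (s j) (hd G hG) hp rfl).trans ?_)
    simp [mul_comm]
  rw [hval]
  have hopt := hopt.trans herr
  rw [abs_le] at hopt hdiff
  rw [abs_lt] at hs ⊢
  constructor <;> linarith [hopt.1, hopt.2, hdiff.1, hdiff.2, hs.1, hs.2]

theorem mainTheorem2 :
    (∀ d : ℕ, IndepNumberTestable {G | IsPlanar G.graph ∧ G.DegreeBounded d}) ∧
    (∀ (d : ℕ) (𝒢 : Set FinGraph), (∀ G ∈ 𝒢, G.DegreeBounded d) → PropertyA 𝒢 →
      IndepNumberTestable 𝒢) := by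
  refine ⟨fun d => indepNumberTestable_of_weightedHyperfinite (fun G hG => hG.2) fun ε hε => ?_,
    fun d 𝒢 hd hA => indepNumberTestable_of_weightedHyperfinite hd
      (weightedHyperfinite_of_propertyA hd hA)⟩
  obtain ⟨R, hR⟩ := weightedHyperfinite_planar ε hε
  exact ⟨R, fun G hG => hR G hG.1⟩
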